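/- Let $T:X\to X$ be a measure-preserving transformation of a probability space $(X,\mathcal B,\mu)$, and let $d\ge 1$. For a function $u$ on $X$ write $\mu(u)=\int_X u\,d\mu$ and $u^n=u\circ T^n$ ($n\ge 0$). Let $f:X\to\mathbb R^d$ be bounded and measurable with $\mu(f)=0$, and let $\|f\|_\infty=\max_{\alpha}\|f_\alpha\|_\infty$, where $\|f_\alpha\|_\infty$ is the $L^\infty(\mu)$-norm of the coordinate function $f_\alpha$. Let $h:\mathbb R^d\to\mathbb R$ be three times differentiable with $\|D^kh\|_\infty<\infty$ for $1\le k\le 3$, where $\|D^kh\|_\infty=\max\{\sup_{\mathbb R^d}|\partial_1^{t_1}\cdots\partial_d^{t_d}h| : t_1+\dots+t_d=k\}$. Fix integers $N>0$ and $0\le K<N$, and for $0\le n<N$ put $$W=\frac1{\sqrt N}\sum_{k=0}^{N-1}f^k,\qquad W^n=W-\frac1{\sqrt N}\sum_{\substack{0\le k<N\\ |k-n|\le K}}f^k .$$ Suppose that the following conditions hold. **(A1)** There are constants $C_2,C_4>0$ and a non-increasing function $\rho:\{0,1,2,\dots\}\to[0,\infty)$ with $\rho(0)=1$ and $\sum_{i\ge1}i\rho(i)<\infty$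 such that $$|\mu(f_\alpha f_\beta^k)|\le C_2\,\rho(k),$$ $$|\mu(f_\alpha f_\beta^l f_\gamma^m f_\delta^n)|\le C_4\min\{\rho(l),\rho(n-m)\},$$ $$|\mu(f_\alpha f_\beta^l f_\gamma^m f_\delta^n)-\mu(f_\alpha f_\beta^l)\,\mu(f_\gamma^m f_\delta^n)|\le C_4\,\rho(m-l)$$ whenever $k\ge0$, $0\le l\le m\le n<N$, $\alpha,\beta,\gamma,\delta\in\{\alpha',\beta'\}$ and $\alpha',\beta'\in\{1,\dots,d\}$. **(A2)** There is a function $\tilde\rho:\{0,1,2,\dots\}\to[0,\infty)$ such that $|\mu(f^n\cdot\nabla h(v+W^nt))|\le\tilde\rho(K)$ for all $0\le n<N$, $0\le t\le1$ and $v\in\mathbb R^d$. **(A3)** $f$ is not a coboundary in any direction: there are no unit vector $v\in\mathbb R^d$ and function $g\in L^2(\mu)$ such that $v\cdot f=g-g\circ T$ $\mu$-almost everywhere. Then the series $$\Sigma=\mu(f\otimes f)+\sum_{n=1}^\infty\bigl(\mu(f^n\otimes f)+\mu(f\otimes f^n)\bigr),\qquad (u\otimes w)_{\alpha\beta}=u_\alpha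 w_\beta,$$ converges absolutely entrywise, $\Sigma$ is a symmetric positive-definite $d\times d$ matrix, and, denoting by $\Phi_\Sigma(h)$ the expectation of $h$ with respect to the centered normal distribution $\mathcal N(0,\Sigma)$ on $\mathbb R^d$, $$|\mu(h(W))-\Phi_\Sigma(h)|\le C_*\Bigl(\frac{K+1}{\sqrt N}+\sum_{i=K+1}^\infty\rho(i)\Bigr)+\sqrt N\,\tilde\rho(K),$$ where $$C_*=12\,d^3\max\{C_2,\sqrt{C_4}\}\bigl(\|D^2h\|_\infty+\|f\|_\infty\|D^3h\|_\infty\bigr)\sum_{i=0}^\infty(i+1)\rho(i)$$ is independent of $N$, $K$ and $\Sigma$. -/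

import Mathlib

open MeasureTheory ProbabilityTheory
open scoped ENNReal

namespace SteinDyn

noncomputable section

/-- The time-`n` observable `f ∘ T^n`. -/
def iter {X E : Type*} (T : X → X) (f : X → E) (n : ℕ) : X → E :=
  fun x => f (T^[n] x)

/-- `W = N^{-1/2} ∑_{k < N} f ∘ T^k`. -/
def W {X : Type*} {d : ℕ} (T : X → X) (f : X → EuclideanSpace ℝ (Fin d)) (N : ℕ) :
    X → EuclideanSpace ℝ (Fin d) :=
  fun x => (1 / √(N : ℝ)) • ∑ k ∈ Finset.range N, iter T f k x

/-- The window `[n]_K = {k ∈ {0, …, N-1} : |k - n| ≤ K}`. -/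
def window (N K n : ℕ) : Finset ℕ :=
  {k ∈ Finset.range N | |(k : ℤ) - (n : ℤ)| ≤ (K : ℤ)}

/-- `W^n = W - N^{-1/2} ∑_{k ∈ [n]_K} f ∘ T^k`. -/
def Wgap {X : Type*} {d : ℕ} (T : X → X) (f : X → EuclideanSpace ℝ (Fin d)) (N K n : ℕ) :
    X → EuclideanSpace ℝ (Fin d) :=
  fun x => W T f N x - (1 / √(N : ℝ)) • ∑ k ∈ window N K n, iter T f k x

/-- `f` is a coboundary in the direction `v`: there is `g ∈ L²(μ)` with `v ⬝ f = g - g ∘ T`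
(an identity of elements of `L²(μ)`, that is, almost everywhere). -/
def IsCoboundaryInDirection {X : Type*} [MeasurableSpace X] {d : ℕ} (μ : Measure X) (T : X → X)
    (f : X → EuclideanSpace ℝ (Fin d)) (v : EuclideanSpace ℝ (Fin d)) : Prop :=
  ∃ g : X → ℝ, MemLp g 2 μ ∧ ∀ᵐ x ∂μ, inner ℝ v (f x) = g x - g (T x)

/-- The norm `‖f‖_∞ = max_α ‖f_α‖_∞`, where `‖f_α‖_∞` is the `L^∞(μ)` norm of the coordinate. -/
def supNorm {X : Type*} [MeasurableSpace X] {d : ℕ} (μ : Measure X)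
    (f : X → EuclideanSpace ℝ (Fin d)) : ℝ≥0∞ :=
  ⨆ α : Fin d, eLpNorm (fun x => f x α) ∞ μ

/-- The partial derivative `∂_{a 0} ⋯ ∂_{a (k-1)} h` of order `k` at the point `w`. -/
def partialDeriv {d k : ℕ} (h : EuclideanSpace ℝ (Fin d) → ℝ) (a : Fin k → Fin d)
    (w : EuclideanSpace ℝ (Fin d)) : ℝ :=
  iteratedFDeriv ℝ k h w fun i => EuclideanSpace.single (a i) 1

/-- `‖D^k h‖_∞`: the largest of the supremum norms of the partial derivatives of order `k` of `h`,
a value in `[0, ∞]`. (The partial derivatives of a `k` times differentiable function do not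
depend on the order of differentiation, so this is the maximum over multi-indices of order `k`.) -/
def derivNorm {d : ℕ} (k : ℕ) (h : EuclideanSpace ℝ (Fin d) → ℝ) : ℝ≥0∞ :=
  ⨆ (a : Fin k → Fin d) (w : EuclideanSpace ℝ (Fin d)), ‖partialDeriv h a w‖ₑ

/-- Decay of correlations of orders two and four, at the rate `ρ` and with constants `C₂`, `C₄`. -/
structure CorrelationDecay {X : Type*} [MeasurableSpace X] {d : ℕ} (μ : Measure X) (T : X → X)
    (f : X → EuclideanSpace ℝ (Fin d)) (N : ℕ) (C₂ C₄ : ℝ) (ρ : ℕ → ℝ) : Prop where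
  C₂_pos : 0 < C₂
  C₄_pos : 0 < C₄
  rate_nonneg : ∀ i, 0 ≤ ρ i
  rate_antitone : Antitone ρ
  rate_zero : ρ 0 = 1
  rate_summable : Summable fun i : ℕ => (i : ℝ) * ρ i
  two : ∀ (α β : Fin d) (k : ℕ), |∫ x, f x α * iter T f k x β ∂μ| ≤ C₂ * ρ k
  four : ∀ α' β' : Fin d, ∀ α ∈ ({α', β'} : Set (Fin d)), ∀ β ∈ ({α', β'} : Set (Fin d)),
    ∀ γ ∈ ({α', β'} : Set (Fin d)), ∀ δ ∈ ({α', β'} : Set (Fin d)),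
    ∀ l m n : ℕ, l ≤ m → m ≤ n → n < N →
      |∫ x, f x α * iter T f l x β * iter T f m x γ * iter T f n x δ ∂μ|
        ≤ C₄ * min (ρ l) (ρ (n - m))
  four_sub : ∀ α' β' : Fin d, ∀ α ∈ ({α', β'} : Set (Fin d)), ∀ β ∈ ({α', β'} : Set (Fin d)),
    ∀ γ ∈ ({α', β'} : Set (Fin d)), ∀ δ ∈ ({α', β'} : Set (Fin d)),
    ∀ l m n : ℕ, l ≤ m → m ≤ n → n < N →
      |(∫ x, f x α * iter T f l x β * iter T f m x γ * iter T f n x δ ∂μ)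
          - (∫ x, f x α * iter T f l x β ∂μ) * ∫ x, iter T f m x γ * iter T f n x δ ∂μ|
        ≤ C₄ * ρ (m - l)

/-- The matrix `μ(u ⊗ v)`. -/
def meanTensor {X : Type*} [MeasurableSpace X] {d : ℕ} (μ : Measure X)
    (u v : X → EuclideanSpace ℝ (Fin d)) : Matrix (Fin d) (Fin d) ℝ :=
  Matrix.of fun α β => ∫ x, u x α * v x β ∂μ

/-- The term `μ(f^n ⊗ f) + μ(f ⊗ f^n)` of the covariance series. -/
def covTerm {X : Type*} [MeasurableSpace X] {d : ℕ} (μ : Measure X) (T : X → X)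
    (f : X → EuclideanSpace ℝ (Fin d)) (n : ℕ) : Matrix (Fin d) (Fin d) ℝ :=
  meanTensor μ (iter T f n) f + meanTensor μ f (iter T f n)

/-- `Σ = μ(f ⊗ f) + ∑_{n ≥ 1} (μ(f^n ⊗ f) + μ(f ⊗ f^n))`, the series being summed entrywise. -/
def covMatrix {X : Type*} [MeasurableSpace X] {d : ℕ} (μ : Measure X) (T : X → X)
    (f : X → EuclideanSpace ℝ (Fin d)) : Matrix (Fin d) (Fin d) ℝ :=
  Matrix.of fun α β => meanTensor μ f f α β + ∑' n : ℕ, covTerm μ T f (n + 1) α β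

/-- `Φ_S(h)`: the expectation of `h` under the centred normal law with covariance matrix `S`. -/
def gaussianMean {d : ℕ} (S : Matrix (Fin d) (Fin d) ℝ) (h : EuclideanSpace ℝ (Fin d) → ℝ) : ℝ :=
  ∫ w, h w ∂(multivariateGaussian 0 S)

/-- `C_* = 12 d³ max{C₂, √C₄} (‖D²h‖_∞ + ‖f‖_∞ ‖D³h‖_∞) ∑_{i ≥ 0} (i + 1) ρ(i)`. -/
def constStar {X : Type*} [MeasurableSpace X] {d : ℕ} (μ : Measure X)
    (f : X → EuclideanSpace ℝ (Fin d)) (h : EuclideanSpace ℝ (Fin d) → ℝ)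
    (C₂ C₄ : ℝ) (ρ : ℕ → ℝ) : ℝ :=
  12 * (d : ℝ) ^ 3 * max C₂ √C₄
    * ((derivNorm 2 h).toReal + (supNorm μ f).toReal * (derivNorm 3 h).toReal)
    * ∑' i : ℕ, ((i : ℝ) + 1) * ρ i

end

end SteinDyn

namespace SteinDyn

/-! ### Gaussian integration by parts and interpolation -/

/-! Let `Z` be Gaussian with covariance Σ, independent of `W`, and put `F θ = E h(cos θ • Z + sin θ
• W)`, so that `F 0` is the Gaussian mean and `F (π/2)` is `μ(h(W))`. In `F'`, Gaussian integration
by parts turns the factor `Z` into `cos θ` times Σ contracted with the Hessian. Hence `F' θ` is `cos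
θ` times an average over `Z` of the Stein expression `E[W·∇h(v + uW) - u Σ:D²h(v + uW)]` with `v =
cos θ • Z`, `u = sin θ`. Cauchy's mean value theorem against `sin` then bounds the distance by the
supremum of this expression over `v` and `u ∈ [0,1]` (`abs_integral_sub_gaussianMean_le`). No Stein
equation is solved: only derivatives of `h` occur, at the points `v + uW` that match (A2).

For fixed `v, u`, write `W` as the normalised sum of the `f^n` and expand `∇h` between `v + uW^n`
and `v + uW` (`stein_decomposition`). The values at `v + uW^n` cost `√N ρ̃(K)` by (A2). The linear
part compares the windowed empirical covariance with Σ. Its variance is small by decay of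
fourth-order correlations (`integral_windowFluct_sq_le`), and its bias is a tail of the covariance
series plus boundary effects (`abs_sum_sum_window_mom₂_sub_le`). The quadratic remainder is
controlled by `‖f‖_∞`, `‖D³h‖_∞` and second moments of window sums.

For definiteness, the quadratic form of Σ at `v` is the asymptotic variance of the Birkhoff sums of
`v·f`: their second moments are `n` times it, up to a bounded error because `∑ iρ(i)` converges. It
is therefore nonnegative, and if it vanished the sums would be bounded in `L²`, making `v·f` a
coboundary (`exists_eq_sub_of_bounded_orbit_sums`), against (A3). -/

theorem hasDerivAt_gaussianPDFReal (x : ℝ) :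
    HasDerivAt (gaussianPDFReal 0 1) (-(x * gaussianPDFReal 0 1 x)) x := by
  have h1 : HasDerivAt (fun y : ℝ => -(y - 0) ^ 2 / (2 * ((1 : NNReal) : ℝ))) (-x) x := by
    have := (((hasDerivAt_id x).pow 2).neg).div_const 2
    simp only [id] at this
    convert! this using 1
    · ext y; simp
    · simp; ring
  have := (h1.exp).const_mul (√(2 * Real.pi * ((1 : NNReal) : ℝ)))⁻¹
  convert! this using 1
  simp only [gaussianPDFReal]
  ring

theorem integrable_id_mul_gaussianPDFReal :
    Integrable (fun x : ℝ => x * gaussianPDFReal 0 1 x) := by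
  have h := (integrable_mul_exp_neg_mul_sq (b := 1 / 2) (by norm_num)).const_mul
    (√(2 * Real.pi * ((1 : NNReal) : ℝ)))⁻¹
  refine h.congr (Filter.Eventually.of_forall fun x => ?_)
  simp only [gaussianPDFReal, sub_zero, NNReal.coe_one, mul_one]
  rw [show -(1 / 2) * x ^ 2 = -x ^ 2 / 2 by ring]
  ring

/-- Gaussian integration by parts on the line. -/
theorem integral_mul_gaussianReal {φ φ' : ℝ → ℝ} (hφ : ∀ x, HasDerivAt φ (φ' x) x) {A B : ℝ}
    (hA : ∀ x, |φ x| ≤ A) (hB : ∀ x, |φ' x| ≤ B) :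
    ∫ x, x * φ x ∂(gaussianReal 0 1) = ∫ x, φ' x ∂(gaussianReal 0 1) := by
  have hφm : Measurable φ := (continuous_iff_continuousAt.2 fun x => (hφ x).continuousAt).measurable
  have hφ'm : Measurable φ' := by
    have : φ' = deriv φ := funext fun x => (hφ x).deriv.symm
    rw [this]; exact measurable_deriv φ
  have hp := integrable_gaussianPDFReal 0 1
  -- The Gaussian density `p` satisfies `(-p)' = x p`, so `-p` is the antiderivative to use;
  -- integrability of the products disposes of the boundary terms.
  have key := integral_mul_deriv_eq_deriv_mul_of_integrable (u := φ) (u' := φ')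
    (v := fun x => -gaussianPDFReal 0 1 x) (v' := fun x => x * gaussianPDFReal 0 1 x)
    (fun x _ => hφ x) (fun x _ => by
      have := (hasDerivAt_gaussianPDFReal x).neg
      rw [neg_neg] at this
      exact this)
    (integrable_id_mul_gaussianPDFReal.bdd_mul hφm.aestronglyMeasurable
      (Filter.Eventually.of_forall hA))
    (hp.neg.bdd_mul hφ'm.aestronglyMeasurable (Filter.Eventually.of_forall hB))
    (hp.neg.bdd_mul hφm.aestronglyMeasurable (Filter.Eventually.of_forall hA))
  rw [integral_gaussianReal_eq_integral_smul one_ne_zero,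
    integral_gaussianReal_eq_integral_smul one_ne_zero]
  simp only [smul_eq_mul]
  calc _ = ∫ x, φ x * (x * gaussianPDFReal 0 1 x) := by congr 1; ext x; ring
    _ = _ := by
      rw [key, ← integral_neg]
      congr 1; ext x; ring

section Gaussian

variable {d : ℕ}

theorem toLp_insertNth {n : ℕ} (i : Fin (n + 1)) (t : ℝ) (y : Fin n → ℝ) :
    WithLp.toLp 2 (i.insertNth (α := fun _ => ℝ) t y)
      = WithLp.toLp 2 (i.insertNth (α := fun _ => ℝ) 0 y)
        + t • EuclideanSpace.single i (1 : ℝ) := by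
  ext j
  refine i.succAboveCases ?_ (fun k => ?_) j <;> simp [Fin.succAbove_ne]

/-- Gaussian integration by parts for the standard Gaussian law. -/
theorem integral_mul_stdGaussian {G : EuclideanSpace ℝ (Fin d) → ℝ} (hG : Differentiable ℝ G)
    (i : Fin d) (hc : Continuous fun z => fderiv ℝ G z (EuclideanSpace.single i 1))
    {A B : ℝ} (hA : ∀ z, |G z| ≤ A) (hB : ∀ z, |fderiv ℝ G z (EuclideanSpace.single i 1)| ≤ B) :
    ∫ z, z i * G z ∂(stdGaussian (EuclideanSpace ℝ (Fin d)))
      = ∫ z, fderiv ℝ G z (EuclideanSpace.single i 1)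
          ∂(stdGaussian (EuclideanSpace ℝ (Fin d))) := by
  obtain _ | n := d
  · exact i.elim0
  have hGc := hG.continuous
  have hm : Measurable (WithLp.toLp 2 : (Fin (n + 1) → ℝ) → EuclideanSpace ℝ (Fin (n + 1))) := by
    fun_prop
  have hmp := (measurePreserving_piFinSuccAbove (fun _ : Fin (n + 1) => gaussianReal 0 1) i).symm
  have hL : Continuous fun p : ℝ × (Fin n → ℝ) =>
      (WithLp.toLp 2 (i.insertNth (α := fun _ => ℝ) p.1 p.2) : EuclideanSpace ℝ (Fin (n + 1))) := by
    refine (PiLp.continuous_toLp 2 _).comp ?_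
    exact Continuous.finInsertNth (A := fun _ => ℝ) i continuous_fst continuous_snd
  -- The standard law is a product: coordinate `i` is split off and integrated first, with the
  -- others frozen, which reduces the claim to the line.
  rw [← map_pi_eq_stdGaussian, integral_map hm.aemeasurable (by fun_prop),
    integral_map hm.aemeasurable (hc.aestronglyMeasurable), ← hmp.integral_comp',
    ← hmp.integral_comp', integral_prod_symm, integral_prod_symm]
  · congr 1
    ext y
    simp only [MeasurableEquiv.piFinSuccAbove_symm_apply, Fin.insertNthEquiv, Equiv.coe_fn_mk,
      Fin.insertNth_apply_same]
    refine integral_mul_gaussianReal (A := A) (B := B) (fun t => ?_) (fun t => hA _) (fun t => hB _)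
    have h2 : HasDerivAt (fun t : ℝ => (WithLp.toLp 2 (i.insertNth (α := fun _ => ℝ) t y) :
        EuclideanSpace ℝ (Fin (n + 1)))) (EuclideanSpace.single i 1) t := by
      have := ((hasDerivAt_id t).smul_const (EuclideanSpace.single i (1 : ℝ))).const_add
        (WithLp.toLp 2 (i.insertNth (α := fun _ => ℝ) 0 y))
      simp only [id, one_smul] at this
      refine this.congr_of_eventuallyEq (Filter.Eventually.of_forall fun s => ?_)
      exact toLp_insertNth i s y
    exact (hG _).hasFDerivAt.comp_hasDerivAt t h2
  · refine Integrable.of_bound (C := B) ?_ (Filter.Eventually.of_forall fun p => hB _)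
    exact (hc.comp hL).aestronglyMeasurable
  · refine Integrable.mul_bdd (c := A) ?_ ?_ (Filter.Eventually.of_forall fun p => hA _)
    · simp only [MeasurableEquiv.piFinSuccAbove_symm_apply, Fin.insertNthEquiv, Equiv.coe_fn_mk,
        Fin.insertNth_apply_same]
      exact Integrable.comp_fst (IsGaussian.integrable_id (μ := gaussianReal 0 1)) _
    · exact (hGc.comp hL).aestronglyMeasurable

open scoped MatrixOrder in
/-- Gaussian integration by parts for a centred Gaussian law with covariance matrix `S`. -/
theorem integral_mul_multivariateGaussian {S : Matrix (Fin d) (Fin d) ℝ} (hS : S.PosSemidef)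
    {G : EuclideanSpace ℝ (Fin d) → ℝ} (hG : Differentiable ℝ G)
    (hc : ∀ i, Continuous fun z => fderiv ℝ G z (EuclideanSpace.single i 1))
    {A B : ℝ} (hA : ∀ z, |G z| ≤ A) (hB : ∀ i z, |fderiv ℝ G z (EuclideanSpace.single i 1)| ≤ B)
    (α : Fin d) :
    ∫ z, z α * G z ∂(multivariateGaussian 0 S)
      = ∑ β, S α β * ∫ z, fderiv ℝ G z (EuclideanSpace.single β 1) ∂(multivariateGaussian 0 S) := by
  -- The law is the image of the standard one under `Q = √S`. One factor `Q` comes from the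
  -- coordinate of the image, another from the chain rule for `G ∘ L`; by symmetry of `Q` they
  -- recombine to `Q * Q = S`.
  set L := Matrix.toEuclideanCLM (𝕜 := ℝ) (CFC.sqrt S) with hL
  set Q := CFC.sqrt S with hQ
  have hQQ : Q * Q = S := by
    exact CFC.sqrt_mul_sqrt_self _ hS.nonneg
  have hQs : ∀ i j, Q i j = Q j i := by
    intro i j
    have : IsSelfAdjoint Q := by exact (CFC.sqrt_nonneg S).isSelfAdjoint
    have h2 : Q.conjTranspose = Q := this
    conv_lhs => rw [← h2]
    simp [Matrix.conjTranspose_apply]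
  have hLx : ∀ x i, L x i = ∑ j, Q i j * x j := by
    intro x i
    simp [hL, Matrix.ofLp_toEuclideanCLM, Matrix.mulVec, dotProduct]
  have hLe : ∀ j, L (EuclideanSpace.single j 1) = ∑ i, Q i j • EuclideanSpace.single i (1 : ℝ) := by
    intro j
    ext i
    rw [hLx]
    simp [Pi.single_apply]
  have hfd : ∀ z j, fderiv ℝ (fun y => G (L y)) z (EuclideanSpace.single j 1)
      = ∑ i, Q i j * fderiv ℝ G (L z) (EuclideanSpace.single i 1) := by
    intro z j
    have : HasFDerivAt (fun y => G (L y)) ((fderiv ℝ G (L z)).comp L) z :=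
      (hG _).hasFDerivAt.comp z L.hasFDerivAt
    rw [this.fderiv, ContinuousLinearMap.comp_apply, hLe, map_sum]
    simp
  have hGL : Differentiable ℝ (fun y => G (L y)) := hG.comp L.differentiable
  have hcL : ∀ i, Continuous fun z => fderiv ℝ G (L z) (EuclideanSpace.single i 1) :=
    fun i => (hc i).comp L.continuous
  have hint : ∀ i, Integrable (fun z => fderiv ℝ G (L z) (EuclideanSpace.single i 1))
      (stdGaussian (EuclideanSpace ℝ (Fin d))) := fun i =>
    Integrable.of_bound (C := B) (hcL i).aestronglyMeasurable
      (Filter.Eventually.of_forall fun p => hB _ _)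
  have hintx : ∀ j, Integrable (fun z : EuclideanSpace ℝ (Fin d) => z j * G (L z))
      (stdGaussian (EuclideanSpace ℝ (Fin d))) := by
    intro j
    refine Integrable.mul_bdd (c := A) ?_ (hG.continuous.comp L.continuous).aestronglyMeasurable
      (Filter.Eventually.of_forall fun p => hA _)
    exact (EuclideanSpace.proj (𝕜 := ℝ) j).integrable_comp
      (IsGaussian.integrable_id (μ := stdGaussian (EuclideanSpace ℝ (Fin d))))
  have hibp : ∀ j, ∫ z, z j * G (L z) ∂(stdGaussian (EuclideanSpace ℝ (Fin d)))
      = ∑ i, Q i j * ∫ z, fderiv ℝ G (L z) (EuclideanSpace.single i 1)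
          ∂(stdGaussian (EuclideanSpace ℝ (Fin d))) := by
    intro j
    rw [integral_mul_stdGaussian hGL j (A := A) (B := ∑ i, |Q i j| * B) ?_ (fun z => hA _) ?_]
    · simp_rw [hfd]
      rw [integral_finsetSum _ fun i _ => (hint i).const_mul _]
      simp_rw [integral_const_mul]
    · simp_rw [hfd]
      exact continuous_finsetSum _ fun i _ => (hcL i).const_mul _
    · intro z
      rw [hfd]
      refine (Finset.abs_sum_le_sum_abs _ _).trans (Finset.sum_le_sum fun i _ => ?_)
      rw [abs_mul]
      exact mul_le_mul_of_nonneg_left (hB _ _) (abs_nonneg _)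
  have hmap : multivariateGaussian 0 S = (stdGaussian (EuclideanSpace ℝ (Fin d))).map L := by
    simp only [multivariateGaussian, zero_add]
    rfl
  rw [hmap, integral_map (f := fun z : EuclideanSpace ℝ (Fin d) => z α * G z)
    L.continuous.aemeasurable
    (((by fun_prop : Continuous fun z : EuclideanSpace ℝ (Fin d) => z α).mul
      hG.continuous).aestronglyMeasurable)]
  simp_rw [fun β => integral_map (μ := stdGaussian (EuclideanSpace ℝ (Fin d)))
    L.continuous.aemeasurable (hc β).aestronglyMeasurable]
  simp_rw [fun y => hLx y α, Finset.sum_mul, mul_assoc]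
  rw [integral_finsetSum _ fun j _ => (hintx j).const_mul _]
  simp_rw [integral_const_mul, hibp, Finset.mul_sum]
  rw [Finset.sum_comm]
  refine Finset.sum_congr rfl fun β _ => ?_
  rw [← hQQ, Matrix.mul_apply, Finset.sum_mul]
  refine Finset.sum_congr rfl fun j _ => ?_
  rw [hQs j β, mul_assoc]

/-- The partial derivative of `g` in the direction of the coordinate `α`. -/
noncomputable def pderiv (α : Fin d) (g : EuclideanSpace ℝ (Fin d) → ℝ)
    (y : EuclideanSpace ℝ (Fin d)) : ℝ :=
  fderiv ℝ g y (EuclideanSpace.single α 1)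

theorem sum_smul_single (w : EuclideanSpace ℝ (Fin d)) :
    ∑ α, w α • EuclideanSpace.single α (1 : ℝ) = w := by
  ext i
  simp [Pi.single_apply]

theorem fderiv_eq_sum_pderiv (g : EuclideanSpace ℝ (Fin d) → ℝ) (y w : EuclideanSpace ℝ (Fin d)) :
    fderiv ℝ g y w = ∑ α, w α * pderiv α g y := by
  conv_lhs => rw [← sum_smul_single w, map_sum]
  simp [pderiv]

/-- Mean value inequality along a segment. The `ℓ¹` norm of the increment is dual to a bound on each
partial derivative, so no extra dimensional factor arises. -/
theorem abs_sub_le_of_pderiv {g : EuclideanSpace ℝ (Fin d) → ℝ} (hg : Differentiable ℝ g) {M : ℝ}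
    (hM : ∀ α y, |pderiv α g y| ≤ M) (y w : EuclideanSpace ℝ (Fin d)) :
    |g (y + w) - g y| ≤ M * ∑ α, |w α| := by
  have hd : ∀ t : ℝ, HasDerivAt (fun t : ℝ => g (y + t • w)) (fderiv ℝ g (y + t • w) w) t := by
    intro t
    have h2 : HasDerivAt (fun t : ℝ => y + t • w) w t := by
      simpa using ((hasDerivAt_id t).smul_const w).const_add y
    exact (hg _).hasFDerivAt.comp_hasDerivAt t h2
  have := norm_image_sub_le_of_norm_deriv_le_segment_01' (C := M * ∑ α, |w α|)
    (fun t _ => (hd t).hasDerivWithinAt) fun t _ => by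
      rw [fderiv_eq_sum_pderiv, Real.norm_eq_abs, Finset.mul_sum]
      refine (Finset.abs_sum_le_sum_abs _ _).trans (Finset.sum_le_sum fun α _ => ?_)
      rw [abs_mul, mul_comm]
      exact mul_le_mul_of_nonneg_right (hM _ _) (abs_nonneg _)
  simpa using this

theorem integrable_sum_abs_multivariateGaussian (S : Matrix (Fin d) (Fin d) ℝ) :
    Integrable (fun z : EuclideanSpace ℝ (Fin d) => ∑ α, |z α|) (multivariateGaussian 0 S) := by
  refine integrable_finsetSum _ fun α _ => Integrable.abs ?_
  exact (EuclideanSpace.proj (𝕜 := ℝ) α).integrable_comp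
      (IsGaussian.integrable_id (μ := multivariateGaussian 0 S))

/-- Differentiation under the integral sign. Since `|cos|, |sin| ≤ 1`, the dominating function does
not depend on `θ`; it is integrable because Gaussian laws have first moments. -/
theorem hasDerivAt_interpolation {X : Type*} [MeasurableSpace X] (μ : Measure X)
    [IsProbabilityMeasure μ] {V : X → EuclideanSpace ℝ (Fin d)} (hV : Measurable V) {A : ℝ}
    (hVA : ∀ x α, |V x α| ≤ A) (S : Matrix (Fin d) (Fin d) ℝ)
    {h : EuclideanSpace ℝ (Fin d) → ℝ} (hh : Differentiable ℝ h)
    (hc : ∀ α, Continuous (pderiv α h)) {M : ℝ} (hM : ∀ α y, |pderiv α h y| ≤ M) (θ : ℝ) :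
    HasDerivAt (fun θ => ∫ p, h (Real.cos θ • p.2 + Real.sin θ • V p.1)
        ∂(μ.prod (multivariateGaussian 0 S)))
      (∫ p : X × EuclideanSpace ℝ (Fin d), ∑ α, (Real.cos θ * V p.1 α - Real.sin θ * p.2 α)
        * pderiv α h (Real.cos θ • p.2 + Real.sin θ • V p.1)
        ∂(μ.prod (multivariateGaussian 0 S))) θ := by
  have hI : Integrable (fun p : X × EuclideanSpace ℝ (Fin d) => ∑ α : Fin d, (A + |p.2 α|) * M)
      (μ.prod (multivariateGaussian 0 S)) := by
    have h1 : Integrable (fun z : EuclideanSpace ℝ (Fin d) => ∑ α : Fin d, (A + |z α|) * M)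
        (multivariateGaussian 0 S) := by
      simp_rw [← Finset.sum_mul, Finset.sum_add_distrib]
      exact ((integrable_const _).add (integrable_sum_abs_multivariateGaussian S)).mul_const _
    exact h1.comp_snd μ
  have hbound : ∀ (p : X × EuclideanSpace ℝ (Fin d)) (θ : ℝ),
      ‖∑ α, (Real.cos θ * V p.1 α - Real.sin θ * p.2 α)
        * pderiv α h (Real.cos θ • p.2 + Real.sin θ • V p.1)‖ ≤ ∑ α : Fin d, (A + |p.2 α|) * M := by
    intro p θ
    rw [Real.norm_eq_abs]
    refine (Finset.abs_sum_le_sum_abs _ _).trans (Finset.sum_le_sum fun α _ => ?_)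
    rw [abs_mul]
    have h0 : 0 ≤ A := (abs_nonneg _).trans (hVA p.1 α)
    refine mul_le_mul ((abs_sub _ _).trans (add_le_add ?_ ?_)) (hM _ _) (abs_nonneg _)
      (add_nonneg h0 (abs_nonneg _))
    · rw [abs_mul]
      exact (mul_le_of_le_one_left (abs_nonneg _) (Real.abs_cos_le_one _)).trans (hVA _ _)
    · rw [abs_mul]
      exact mul_le_of_le_one_left (abs_nonneg _) (Real.abs_sin_le_one _)
  have hYm : ∀ θ : ℝ, Measurable fun p : X × EuclideanSpace ℝ (Fin d) =>
      Real.cos θ • p.2 + Real.sin θ • V p.1 := fun θ => by fun_prop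
  have hhm : ∀ θ : ℝ, AEStronglyMeasurable (fun p : X × EuclideanSpace ℝ (Fin d) =>
      h (Real.cos θ • p.2 + Real.sin θ • V p.1)) (μ.prod (multivariateGaussian 0 S)) := fun θ =>
    (hh.continuous.measurable.comp (hYm θ)).aestronglyMeasurable
  refine (hasDerivAt_integral_of_dominated_loc_of_deriv_le (s := Set.univ) Filter.univ_mem
    (F := fun θ (p : X × EuclideanSpace ℝ (Fin d)) => h (Real.cos θ • p.2 + Real.sin θ • V p.1))
    (F' := fun θ (p : X × EuclideanSpace ℝ (Fin d)) =>
      ∑ α, (Real.cos θ * V p.1 α - Real.sin θ * p.2 α)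
        * pderiv α h (Real.cos θ • p.2 + Real.sin θ • V p.1))
    (Filter.Eventually.of_forall hhm) ?_ ?_
    (Filter.Eventually.of_forall fun p θ _ => hbound p θ) hI
    (Filter.Eventually.of_forall fun p θ _ => ?_)).2
  · have h1 : Integrable (fun p : X × EuclideanSpace ℝ (Fin d) =>
        |h 0| + ∑ α : Fin d, (A + |p.2 α|) * M) (μ.prod (multivariateGaussian 0 S)) :=
      (integrable_const _).add hI
    refine h1.mono' (hhm θ) (Filter.Eventually.of_forall fun p => ?_)
    have h2 := abs_sub_le_of_pderiv hh hM 0 (Real.cos θ • p.2 + Real.sin θ • V p.1)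
    rw [zero_add] at h2
    have h3 : M * ∑ α, |(Real.cos θ • p.2 + Real.sin θ • V p.1) α|
        ≤ ∑ α : Fin d, (A + |p.2 α|) * M := by
      rw [Finset.mul_sum]
      refine Finset.sum_le_sum fun α _ => ?_
      rw [mul_comm]
      have hM0 : 0 ≤ M := (abs_nonneg _).trans (hM α 0)
      refine mul_le_mul_of_nonneg_right ?_ hM0
      simp only [PiLp.add_apply, PiLp.smul_apply, smul_eq_mul]
      rw [add_comm A]
      refine (abs_add_le _ _).trans (add_le_add ?_ ?_)
      · rw [abs_mul]
        exact mul_le_of_le_one_left (abs_nonneg _) (Real.abs_cos_le_one _)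
      · rw [abs_mul]
        exact (mul_le_of_le_one_left (abs_nonneg _) (Real.abs_sin_le_one _)).trans (hVA _ _)
    have h4 := abs_sub_abs_le_abs_sub (h (Real.cos θ • p.2 + Real.sin θ • V p.1)) (h 0)
    rw [Real.norm_eq_abs]
    linarith
  · refine Measurable.aestronglyMeasurable ?_
    refine Finset.measurable_sum _ fun α _ => Measurable.mul ?_ ((hc α).measurable.comp (hYm θ))
    fun_prop
  · have h1 : HasDerivAt (fun θ : ℝ => Real.cos θ • p.2 + Real.sin θ • V p.1)
        (-Real.sin θ • p.2 + Real.cos θ • V p.1) θ :=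
      ((Real.hasDerivAt_cos θ).smul_const p.2).add ((Real.hasDerivAt_sin θ).smul_const (V p.1))
    have h2 := (hh (Real.cos θ • p.2 + Real.sin θ • V p.1)).hasFDerivAt.comp_hasDerivAt θ h1
    rw [fderiv_eq_sum_pderiv] at h2
    convert! h2 using 1
    refine Finset.sum_congr rfl fun α _ => ?_
    simp only [PiLp.add_apply, PiLp.smul_apply, smul_eq_mul]
    ring

/-- The chain rule produces the factor `c`. With `c = cos θ` it lets `cos θ` be factored out of the
whole derivative of the interpolation. -/
theorem integral_interpolation {S : Matrix (Fin d) (Fin d) ℝ} (hS : S.PosSemidef)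
    {h : EuclideanSpace ℝ (Fin d) → ℝ}
    (hd : ∀ α, Differentiable ℝ (pderiv α h))
    (hc : ∀ α β, Continuous (pderiv β (pderiv α h))) {M M' : ℝ} (hM : ∀ α y, |pderiv α h y| ≤ M)
    (hM' : ∀ α β y, |pderiv β (pderiv α h) y| ≤ M') (w : EuclideanSpace ℝ (Fin d)) (c : ℝ)
    (α : Fin d) :
    ∫ z, z α * pderiv α h (c • z + w) ∂(multivariateGaussian 0 S)
      = c * ∑ β, S α β * ∫ z, pderiv β (pderiv α h) (c • z + w) ∂(multivariateGaussian 0 S) := by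
  have hfd : ∀ z β, fderiv ℝ (fun z => pderiv α h (c • z + w)) z (EuclideanSpace.single β 1)
      = c * pderiv β (pderiv α h) (c • z + w) := by
    intro z β
    have h1 : HasFDerivAt (fun z : EuclideanSpace ℝ (Fin d) => c • z + w)
        (c • ContinuousLinearMap.id ℝ (EuclideanSpace ℝ (Fin d))) z :=
      ((hasFDerivAt_id z).const_smul c).add_const w
    have h2 := ((hd α) (c • z + w)).hasFDerivAt.comp z h1
    rw [show (fun z => pderiv α h (c • z + w)) = pderiv α h ∘ fun z => c • z + w from rfl,
      h2.fderiv]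
    simp [pderiv]
  have hcont : Continuous fun z : EuclideanSpace ℝ (Fin d) => c • z + w := by fun_prop
  rw [integral_mul_multivariateGaussian hS (G := fun z => pderiv α h (c • z + w)) (A := M)
    (B := |c| * M') ?_ ?_ (fun z => hM _ _) ?_ α]
  · simp_rw [hfd, integral_const_mul, Finset.mul_sum]
    refine Finset.sum_congr rfl fun β _ => ?_
    ring
  · exact (hd α).comp (by fun_prop)
  · intro i
    simp_rw [hfd]
    exact ((hc α i).comp hcont).const_mul c
  · intro i z
    rw [hfd, abs_mul]
    exact mul_le_mul_of_nonneg_left (hM' _ _ _) (abs_nonneg _)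

/-- Comparison with a Gaussian law by interpolation: a bound for the Stein operator, uniform over
translations and contractions of the test function, bounds the distance to the Gaussian mean. -/
theorem abs_integral_sub_gaussianMean_le {X : Type*} [MeasurableSpace X] (μ : Measure X)
    [IsProbabilityMeasure μ] {V : X → EuclideanSpace ℝ (Fin d)} (hV : Measurable V) {A : ℝ}
    (hVA : ∀ x α, |V x α| ≤ A) {S : Matrix (Fin d) (Fin d) ℝ} (hS : S.PosSemidef)
    {h : EuclideanSpace ℝ (Fin d) → ℝ} (hh : Differentiable ℝ h)
    (hd : ∀ α, Differentiable ℝ (pderiv α h))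
    (hc : ∀ α β, Continuous (pderiv β (pderiv α h))) {M M' : ℝ} (hM : ∀ α y, |pderiv α h y| ≤ M)
    (hM' : ∀ α β y, |pderiv β (pderiv α h) y| ≤ M') {B : ℝ}
    (hB : ∀ (v : EuclideanSpace ℝ (Fin d)) (u : ℝ), 0 ≤ u → u ≤ 1 →
      |∫ x, ((∑ α, V x α * pderiv α h (v + u • V x))
        - u * ∑ α, ∑ β, S α β * pderiv β (pderiv α h) (v + u • V x)) ∂μ| ≤ B) :
    |(∫ x, h (V x) ∂μ) - gaussianMean S h| ≤ B := by
  set ν := multivariateGaussian 0 S with hν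
  set F : ℝ → ℝ := fun θ => ∫ p, h (Real.cos θ • p.2 + Real.sin θ • V p.1) ∂(μ.prod ν) with hF
  have hD := fun θ => hasDerivAt_interpolation μ hV hVA S hh (fun α => (hd α).continuous) hM θ
  have hYm : ∀ θ : ℝ, Measurable fun p : X × EuclideanSpace ℝ (Fin d) =>
      Real.cos θ • p.2 + Real.sin θ • V p.1 := fun θ => by fun_prop
  have hzi : ∀ α, Integrable (fun z : EuclideanSpace ℝ (Fin d) => z α) ν := fun α =>
    (EuclideanSpace.proj (𝕜 := ℝ) α).integrable_comp (IsGaussian.integrable_id (μ := ν))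
  have hV1 : ∀ θ α, Integrable (fun p : X × EuclideanSpace ℝ (Fin d) =>
      V p.1 α * pderiv α h (Real.cos θ • p.2 + Real.sin θ • V p.1)) (μ.prod ν) := fun θ α => by
    refine Integrable.mul_bdd (c := M) ?_
      ((hd α).continuous.measurable.comp (hYm θ)).aestronglyMeasurable
      (Filter.Eventually.of_forall fun p => hM _ _)
    exact Integrable.of_bound (C := A) (Measurable.aestronglyMeasurable (by fun_prop))
      (Filter.Eventually.of_forall fun p => hVA _ _)
  have hZ1 : ∀ θ α, Integrable (fun p : X × EuclideanSpace ℝ (Fin d) =>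
      p.2 α * pderiv α h (Real.cos θ • p.2 + Real.sin θ • V p.1)) (μ.prod ν) := fun θ α =>
    Integrable.mul_bdd (c := M) ((hzi α).comp_snd μ)
      ((hd α).continuous.measurable.comp (hYm θ)).aestronglyMeasurable
      (Filter.Eventually.of_forall fun p => hM _ _)
  have hP2 : ∀ θ α β, Integrable (fun p : X × EuclideanSpace ℝ (Fin d) =>
      pderiv β (pderiv α h) (Real.cos θ • p.2 + Real.sin θ • V p.1)) (μ.prod ν) := fun θ α β =>
    Integrable.of_bound (C := M') ((hc α β).measurable.comp (hYm θ)).aestronglyMeasurable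
      (Filter.Eventually.of_forall fun p => hM' _ _ _)
  have hF' : ∀ θ : ℝ, (∫ p : X × EuclideanSpace ℝ (Fin d),
      ∑ α, (Real.cos θ * V p.1 α - Real.sin θ * p.2 α)
        * pderiv α h (Real.cos θ • p.2 + Real.sin θ • V p.1) ∂(μ.prod ν))
      = Real.cos θ * ∫ z, ∫ x, ((∑ α, V x α * pderiv α h (Real.cos θ • z + Real.sin θ • V x))
        - Real.sin θ * ∑ α, ∑ β, S α β
          * pderiv β (pderiv α h) (Real.cos θ • z + Real.sin θ • V x)) ∂μ ∂ν := by
    intro θ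
    have hS1 : Integrable (fun p : X × EuclideanSpace ℝ (Fin d) => ∑ α, V p.1 α *
        pderiv α h (Real.cos θ • p.2 + Real.sin θ • V p.1)) (μ.prod ν) :=
      integrable_finsetSum _ fun α _ => hV1 θ α
    have hS2 : Integrable (fun p : X × EuclideanSpace ℝ (Fin d) => ∑ α, ∑ β, S α β *
        pderiv β (pderiv α h) (Real.cos θ • p.2 + Real.sin θ • V p.1)) (μ.prod ν) :=
      integrable_finsetSum _ fun α _ => integrable_finsetSum _ fun β _ => (hP2 θ α β).const_mul _
    rw [← integral_prod_symm (f := fun p : X × EuclideanSpace ℝ (Fin d) =>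
      (∑ α, V p.1 α * pderiv α h (Real.cos θ • p.2 + Real.sin θ • V p.1))
        - Real.sin θ * ∑ α, ∑ β, S α β
          * pderiv β (pderiv α h) (Real.cos θ • p.2 + Real.sin θ • V p.1))
        (hS1.sub (hS2.const_mul _)),
      integral_sub hS1 (hS2.const_mul _), integral_const_mul]
    have e1 : ∀ p : X × EuclideanSpace ℝ (Fin d),
        ∑ α, (Real.cos θ * V p.1 α - Real.sin θ * p.2 α)
          * pderiv α h (Real.cos θ • p.2 + Real.sin θ • V p.1)
        = Real.cos θ * (∑ α, V p.1 α * pderiv α h (Real.cos θ • p.2 + Real.sin θ • V p.1))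
          - Real.sin θ * ∑ α, p.2 α * pderiv α h (Real.cos θ • p.2 + Real.sin θ • V p.1) := by
      intro p
      rw [Finset.mul_sum, Finset.mul_sum, ← Finset.sum_sub_distrib]
      exact Finset.sum_congr rfl fun α _ => by ring
    simp_rw [e1]
    rw [integral_sub (hS1.const_mul _) ((integrable_finsetSum _ fun α _ => hZ1 θ α).const_mul _),
      integral_const_mul, integral_const_mul, mul_sub, mul_left_comm]
    congr 2
    have e2 : ∫ p : X × EuclideanSpace ℝ (Fin d), ∑ α, ∑ β, S α β *
        pderiv β (pderiv α h) (Real.cos θ • p.2 + Real.sin θ • V p.1) ∂(μ.prod ν)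
        = ∑ α, ∑ β, S α β * ∫ x, ∫ z,
          pderiv β (pderiv α h) (Real.cos θ • z + Real.sin θ • V x) ∂ν ∂μ := by
      refine (integral_finsetSum _ fun α _ =>
        integrable_finsetSum _ fun β _ => (hP2 θ α β).const_mul _).trans ?_
      refine Finset.sum_congr rfl fun α _ => ?_
      refine (integral_finsetSum _ fun β _ => (hP2 θ α β).const_mul _).trans ?_
      refine Finset.sum_congr rfl fun β _ => ?_
      rw [integral_const_mul, integral_prod _ (hP2 θ α β)]
    rw [integral_finsetSum _ fun α _ => hZ1 θ α, e2, Finset.mul_sum]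
    refine Finset.sum_congr rfl fun α _ => ?_
    rw [integral_prod _ (hZ1 θ α)]
    simp_rw [hν, integral_interpolation hS hd hc hM hM']
    rw [integral_const_mul]
    congr 1
    refine (integral_finsetSum _ fun β _ => ((hP2 θ α β).integral_prod_left).const_mul _).trans ?_
    exact Finset.sum_congr rfl fun β _ => integral_const_mul _ _
  -- Cauchy's mean value theorem against `sin`: the factor `cos θ` in `F'` is the derivative of
  -- `sin`, and `sin` increases by exactly 1, so the bound `B` passes through with no loss.
  obtain ⟨θ, hθ, hslope⟩ := exists_ratio_hasDerivAt_eq_ratio_slope F _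
    (a := 0) (b := Real.pi / 2) (by positivity) (fun θ _ => (hD θ).continuousAt.continuousWithinAt)
    (fun θ _ => hD θ) Real.sin Real.cos Real.continuous_sin.continuousOn
    (fun θ _ => Real.hasDerivAt_sin θ)
  have hcos : 0 < Real.cos θ := Real.cos_pos_of_mem_Ioo ⟨by linarith [hθ.1, Real.pi_pos], hθ.2⟩
  have hsin : 0 ≤ Real.sin θ :=
    Real.sin_nonneg_of_nonneg_of_le_pi hθ.1.le (by linarith [hθ.2, Real.pi_pos])
  rw [hF', Real.sin_pi_div_two, Real.sin_zero, sub_zero, one_mul, mul_comm] at hslope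
  have hval := mul_right_cancel₀ hcos.ne' hslope
  have hF1 : F (Real.pi / 2) = ∫ x, h (V x) ∂μ := by
    simp only [hF, Real.cos_pi_div_two, Real.sin_pi_div_two, zero_smul, one_smul, zero_add]
    rw [integral_fun_fst (fun x => h (V x))]
    simp
  have hF0 : F 0 = gaussianMean S h := by
    simp only [hF, Real.cos_zero, Real.sin_zero, zero_smul, one_smul, add_zero]
    rw [integral_fun_snd h]
    simp [gaussianMean, hν]
  rw [← hF1, ← hF0, ← hval, ← Real.norm_eq_abs]
  refine (norm_integral_le_of_norm_le_const (C := B) (Filter.Eventually.of_forall fun z => ?_)).trans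
    (by simp)
  exact hB _ _ hsin (Real.sin_le_one θ)

end Gaussian

/-! ### Bounded measurable functions -/

/-- A bounded measurable real function. -/
def BddMeas {X : Type*} [MeasurableSpace X] (g : X → ℝ) : Prop :=
  Measurable g ∧ ∃ C, ∀ x, |g x| ≤ C

namespace BddMeas

variable {X : Type*} [MeasurableSpace X] {g k : X → ℝ}

theorem add (hg : BddMeas g) (hk : BddMeas k) : BddMeas fun x => g x + k x := by
  obtain ⟨hgm, C, hC⟩ := hg
  obtain ⟨hkm, D, hD⟩ := hk
  exact ⟨hgm.add hkm, C + D, fun x => (abs_add_le _ _).trans (add_le_add (hC x) (hD x))⟩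

theorem mul (hg : BddMeas g) (hk : BddMeas k) : BddMeas fun x => g x * k x := by
  obtain ⟨hgm, C, hC⟩ := hg
  obtain ⟨hkm, D, hD⟩ := hk
  refine ⟨hgm.mul hkm, C * D, fun x => ?_⟩
  rw [abs_mul]
  exact mul_le_mul (hC x) (hD x) (abs_nonneg _) ((abs_nonneg _).trans (hC x))

theorem const (c : ℝ) : BddMeas fun _ : X => c := ⟨measurable_const, |c|, fun _ => le_rfl⟩

theorem const_mul (hg : BddMeas g) (c : ℝ) : BddMeas fun x => c * g x := (const c).mul hg

theorem sub (hg : BddMeas g) (hk : BddMeas k) : BddMeas fun x => g x - k x := by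
  simpa [sub_eq_add_neg] using hg.add (hk.const_mul (-1))

theorem abs (hg : BddMeas g) : BddMeas fun x => |g x| :=
  ⟨hg.1.abs, hg.2.imp fun _ hC x => (abs_abs _).trans_le (hC x)⟩

theorem pow (hg : BddMeas g) (n : ℕ) : BddMeas fun x => g x ^ n := by
  induction n with
  | zero => simpa using const (X := X) 1
  | succ n ih => simpa [pow_succ] using ih.mul hg

theorem sum {ι : Type*} (s : Finset ι) {G : ι → X → ℝ} (hG : ∀ i ∈ s, BddMeas (G i)) :
    BddMeas fun x => ∑ i ∈ s, G i x := by
  classical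
  induction s using Finset.induction_on with
  | empty => simpa using const (X := X) 0
  | insert i s hi ih =>
    simp only [Finset.sum_insert hi]
    exact (hG i (Finset.mem_insert_self _ _)).add
      (ih fun j hj => hG j (Finset.mem_insert_of_mem hj))

theorem comp {Y : Type*} [MeasurableSpace Y] (hg : BddMeas g) {T : Y → X} (hT : Measurable T) :
    BddMeas fun y => g (T y) :=
  ⟨hg.1.comp hT, hg.2.imp fun _ hC _ => hC _⟩

theorem memLp (hg : BddMeas g) {μ : Measure X} [IsFiniteMeasure μ] (p : ℝ≥0∞) : MemLp g p μ := by
  obtain ⟨hgm, C, hC⟩ := hg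
  exact MemLp.of_bound hgm.aestronglyMeasurable C (Filter.Eventually.of_forall hC)

theorem integrable (hg : BddMeas g) {μ : Measure X} [IsFiniteMeasure μ] : Integrable g μ :=
  memLp_one_iff_integrable.1 (hg.memLp 1)

end BddMeas

theorem integral_comp_measurePreserving {X : Type*} [MeasurableSpace X] {μ : Measure X} {T : X → X}
    (hT : MeasurePreserving T μ μ) {g : X → ℝ} (hg : Measurable g) :
    ∫ x, g (T x) ∂μ = ∫ x, g x ∂μ := by
  conv_rhs => rw [← hT.map_eq]
  exact (integral_map hT.measurable.aemeasurable hg.aestronglyMeasurable).symm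

/-! ### Tails of a summable rate -/

/-- The tail `∑_{i ≥ n} ρ(i)`. -/
noncomputable def tail (ρ : ℕ → ℝ) (n : ℕ) : ℝ := ∑' i, ρ (n + i)

section Rate

variable {ρ : ℕ → ℝ} (h0 : ∀ i, 0 ≤ ρ i) (hs : Summable fun i : ℕ => (i : ℝ) * ρ i)

include h0 hs in
theorem summable_rate : Summable ρ := by
  rw [← summable_nat_add_iff 1]
  refine Summable.of_nonneg_of_le (fun i => h0 _) (fun i => ?_) ((summable_nat_add_iff 1).2 hs)
  have : (1 : ℝ) ≤ ((i + 1 : ℕ) : ℝ) := by push_cast; linarith [(Nat.cast_nonneg i : (0 : ℝ) ≤ i)]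
  exact le_mul_of_one_le_left (h0 _) this

include h0 hs in
theorem summable_succ_mul_rate : Summable fun i : ℕ => ((i : ℝ) + 1) * ρ i := by
  simpa [add_mul] using hs.add (summable_rate h0 hs)

include h0 hs in
theorem summable_rate_add (n : ℕ) : Summable fun i => ρ (n + i) := by
  simpa [add_comm] using (summable_nat_add_iff n).2 (summable_rate h0 hs)

include h0 in
theorem tail_nonneg (n : ℕ) : 0 ≤ tail ρ n := tsum_nonneg fun _ => h0 _

include h0 hs in
theorem sum_le_tail (n : ℕ) (s : Finset ℕ) (hn : ∀ i ∈ s, n ≤ i) : ∑ i ∈ s, ρ i ≤ tail ρ n := by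
  rw [← Finset.sum_nbij' (s := s.image fun i => i - n) (t := s) (f := fun i => ρ (n + i))
    (fun i => n + i) (fun i => i - n)]
  · exact (summable_rate_add h0 hs n).sum_le_tsum _ fun i _ => h0 _
  · intro a ha
    obtain ⟨i, hi, rfl⟩ := Finset.mem_image.1 ha
    rwa [Nat.add_sub_of_le (hn i hi)]
  · intro a ha
    exact Finset.mem_image_of_mem _ ha
  · intro a ha
    simp
  · intro a ha
    exact Nat.add_sub_of_le (hn a ha)
  · intro a ha
    rfl

include h0 hs in
theorem summable_succ_mul_rate_add (n : ℕ) : Summable fun i : ℕ => ((i : ℝ) + 1) * ρ (n + i) := by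
  have h1 := (summable_nat_add_iff n).2 (summable_succ_mul_rate h0 hs)
  refine Summable.of_nonneg_of_le (fun i => mul_nonneg (by positivity) (h0 _)) (fun i => ?_) h1
  rw [add_comm n i]
  refine mul_le_mul_of_nonneg_right ?_ (h0 _)
  push_cast
  linarith [(Nat.cast_nonneg n : (0 : ℝ) ≤ n)]

include h0 hs in
theorem tsum_succ_mul_rate_eq (n : ℕ) :
    ∑' i : ℕ, ((i : ℝ) + 1) * ρ (n + i)
      = tail ρ n + ∑' i : ℕ, ((i : ℝ) + 1) * ρ (n + 1 + i) := by
  have h1 := summable_succ_mul_rate_add h0 hs n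
  have h2 := summable_rate_add h0 hs n
  have h3 : Summable fun i : ℕ => (i : ℝ) * ρ (n + i) := by
    simpa [add_mul] using h1.sub h2
  have h4 : ∑' i : ℕ, ((i : ℝ) + 1) * ρ (n + i) = ∑' i : ℕ, (i : ℝ) * ρ (n + i) + tail ρ n := by
    rw [tail, ← h3.tsum_add h2]
    exact tsum_congr fun i => by ring
  rw [h4, h3.tsum_eq_zero_add, add_comm]
  simp only [Nat.cast_zero, zero_mul, zero_add, add_right_inj]
  refine tsum_congr fun i => ?_
  push_cast
  rw [show n + (i + 1) = n + 1 + i by ring]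

include h0 hs in
-- Exchanging the sums, each `ρ i` is counted at most `i` times. The induction is the telescoping
-- form of this, by `tsum_succ_mul_rate_eq`.
theorem sum_tail_le (N : ℕ) :
    ∑ n ∈ Finset.range N, tail ρ (n + 1) ≤ ∑' i : ℕ, ((i : ℝ) + 1) * ρ i := by
  have key : ∀ N : ℕ, ∑ n ∈ Finset.range N, tail ρ n
      + ∑' i : ℕ, ((i : ℝ) + 1) * ρ (N + i) = ∑' i : ℕ, ((i : ℝ) + 1) * ρ i := by
    intro N
    induction N with
    | zero => simp
    | succ N ih => rw [Finset.sum_range_succ, add_assoc, ← tsum_succ_mul_rate_eq h0 hs, ih]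
  have h1 := key (N + 1)
  rw [Finset.sum_range_succ'] at h1
  have h2 : 0 ≤ ∑' i : ℕ, ((i : ℝ) + 1) * ρ (N + 1 + i) :=
    tsum_nonneg fun i => mul_nonneg (by positivity) (h0 _)
  linarith [tail_nonneg h0 0]

include h0 hs in
theorem tail_zero_le : tail ρ 0 ≤ ∑' i : ℕ, ((i : ℝ) + 1) * ρ i := by
  refine (summable_rate_add h0 hs 0).tsum_le_tsum (fun i => ?_) (summable_succ_mul_rate h0 hs)
  rw [zero_add]
  exact le_mul_of_one_le_left (h0 _) (by linarith [(Nat.cast_nonneg i : (0 : ℝ) ≤ i)])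

include h0 hs in
theorem one_le_tsum_succ_mul_rate (h1 : ρ 0 = 1) : 1 ≤ ∑' i : ℕ, ((i : ℝ) + 1) * ρ i := by
  have := (summable_succ_mul_rate h0 hs).sum_le_tsum {0}
    fun i _ => mul_nonneg (by positivity) (h0 _)
  simpa [h1] using this

end Rate

/-! ### Coboundaries -/

open Filter Topology in
/-- In a Hilbert space, a vector whose partial orbit sums under a bounded operator `U` are bounded
lies in the range of `1 - U`. -/
theorem exists_eq_sub_of_bounded_orbit_sums {H : Type*} [NormedAddCommGroup H]
    [InnerProductSpace ℝ H] [CompleteSpace H] (U : H →L[ℝ] H) {g : H} {S : ℕ → H} (hS0 : S 0 = 0)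
    (hS : ∀ n, S (n + 1) = g + U (S n)) {B : ℝ} (hB : ∀ n, ‖S n‖ ≤ B) : ∃ G, g = G - U G := by
  -- Cesàro averages of the orbit sums: they stay in the ball of radius `B`, and telescoping gives
  -- `A n - U (A n) = g - S (n+1)/(n+1)`, which tends to `g`.
  set A : ℕ → H := fun n => ((n : ℝ) + 1)⁻¹ • ∑ j ∈ Finset.range (n + 1), S j with hA
  have hB0 : 0 ≤ B := (norm_nonneg _).trans (hB 0)
  have hAB : ∀ n, ‖A n‖ ≤ B := by
    intro n
    have hpos : (0 : ℝ) < (n : ℝ) + 1 := by positivity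
    rw [hA, norm_smul, Real.norm_eq_abs, abs_of_pos (inv_pos.2 hpos), inv_mul_le_iff₀ hpos]
    refine (norm_sum_le _ _).trans ((Finset.sum_le_sum fun j _ => hB j).trans ?_)
    simp
  have hdiff : ∀ n, A n - U (A n) = g - ((n : ℝ) + 1)⁻¹ • S (n + 1) := by
    intro n
    have hpos : ((n : ℝ) + 1) ≠ 0 := by positivity
    have h1 : ∀ n, ∑ j ∈ Finset.range n, (S j - U (S j)) = (n : ℝ) • g - S n := by
      intro n
      induction n with
      | zero => simp [hS0]
      | succ n ih =>
        rw [Finset.sum_range_succ, ih, hS]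
        push_cast
        rw [add_smul, one_smul]
        abel
    have h2 := h1 (n + 1)
    simp only [hA, map_smul, map_sum, ← smul_sub, ← Finset.sum_sub_distrib]
    rw [h2, smul_sub, smul_smul]
    push_cast
    rw [inv_mul_cancel₀ hpos, one_smul]
  -- Banach–Alaoglu along a nonprincipal ultrafilter yields a weak limit `G` of the averages. Moving
  -- `U` to its adjoint shows that `U (A n)` converges weakly to `U G`.
  obtain ⟨ℓ, -, hℓ⟩ := (WeakDual.isCompact_closedBall (𝕜 := ℝ) (E := H) 0 B).ultrafilter_le_nhds
    ((hyperfilter ℕ : Ultrafilter ℕ).map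
      fun n => StrongDual.toWeakDual (InnerProductSpace.toDual ℝ H (A n))) (by
        rw [Ultrafilter.coe_map, le_principal_iff, mem_map]
        refine Filter.univ_mem' fun n => ?_
        simpa using hAB n)
  set G := (InnerProductSpace.toDual ℝ H).symm (WeakDual.toStrongDual ℓ) with hG
  have hlim : ∀ y, Tendsto (fun n => inner ℝ (A n) y) (hyperfilter ℕ : Filter ℕ)
      (𝓝 (inner ℝ G y)) := by
    intro y
    have h1 := ((WeakDual.eval_continuous y).tendsto ℓ).mono_left hℓ
    rw [Ultrafilter.coe_map, tendsto_map'_iff] at h1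
    rw [hG, InnerProductSpace.toDual_symm_apply]
    exact h1
  refine ⟨G, ext_inner_right ℝ fun y => ?_⟩
  have h1 : Tendsto (fun n => inner ℝ (A n - U (A n)) y) (hyperfilter ℕ : Filter ℕ)
      (𝓝 (inner ℝ (G - U G) y)) := by
    simp only [inner_sub_left]
    refine (hlim y).sub ?_
    simp only [← ContinuousLinearMap.adjoint_inner_right]
    exact hlim _
  have h2 : Tendsto (fun n => inner ℝ (A n - U (A n)) y) (hyperfilter ℕ : Filter ℕ)
      (𝓝 (inner ℝ g y)) := by
    have h3 : Tendsto (fun n : ℕ => A n - U (A n)) atTop (𝓝 g) := by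
      simp only [hdiff]
      have h4 : Tendsto (fun n : ℕ => ((n : ℝ) + 1)⁻¹ • S (n + 1)) atTop (𝓝 0) := by
        refine squeeze_zero_norm (a := fun n : ℕ => 1 / ((n : ℝ) + 1) * B) (fun n => ?_) ?_
        · rw [norm_smul, Real.norm_eq_abs, abs_of_pos (by positivity), one_div]
          exact mul_le_mul_of_nonneg_left (hB _) (by positivity)
        · simpa using (tendsto_one_div_add_atTop_nhds_zero_nat (𝕜 := ℝ)).mul_const B
      simpa using tendsto_const_nhds.sub h4
    exact ((h3.inner tendsto_const_nhds).mono_left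
      (by rw [← Nat.cofinite_eq_atTop]; exact hyperfilter_le_cofinite))
  exact tendsto_nhds_unique h2 h1

/-! ### Variance growth of Birkhoff sums -/

section Birkhoff

variable {X : Type*} [MeasurableSpace X] {μ : Measure X} [IsProbabilityMeasure μ] {T : X → X}
  (hT : MeasurePreserving T μ μ) {g : X → ℝ} (hg : BddMeas g)

omit [IsProbabilityMeasure μ] in
include hT hg in
theorem bddMeas_birkhoffSum (n : ℕ) : BddMeas (birkhoffSum T g n) :=
  BddMeas.sum _ fun k _ => hg.comp (hT.measurable.iterate k)

include hT hg in
-- Square `S_{n+1} = g + S_n ∘ T` and use invariance for the term `(S_n ∘ T)²`.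
theorem integral_birkhoffSum_sq_succ (n : ℕ) :
    ∫ x, birkhoffSum T g (n + 1) x ^ 2 ∂μ = ∫ x, birkhoffSum T g n x ^ 2 ∂μ
      + (∫ x, g x * g x ∂μ + 2 * ∑ k ∈ Finset.range n, ∫ x, g x * g (T^[k + 1] x) ∂μ) := by
  have hS := bddMeas_birkhoffSum hT hg n
  have hST := hS.comp hT.measurable
  have h1 : ∫ x, g x * birkhoffSum T g n (T x) ∂μ
      = ∑ k ∈ Finset.range n, ∫ x, g x * g (T^[k + 1] x) ∂μ := by
    simp only [birkhoffSum, Finset.mul_sum, Function.iterate_succ_apply]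
    exact integral_finsetSum _ fun k _ =>
      (hg.mul ((hg.comp (hT.measurable.iterate k)).comp hT.measurable)).integrable
  rw [← h1, ← integral_comp_measurePreserving hT (hS.pow 2).1, ← integral_const_mul,
    ← integral_add (hg.mul hg).integrable ((hg.mul hST).const_mul 2).integrable,
    ← integral_add (hST.pow 2).integrable ((hg.mul hg).add ((hg.mul hST).const_mul 2)).integrable]
  refine integral_congr_ae (Filter.Eventually.of_forall fun x => ?_)
  simp only [birkhoffSum_succ']
  ring

variable {ρ : ℕ → ℝ} (h0 : ∀ i, 0 ≤ ρ i) (hs : Summable fun i : ℕ => (i : ℝ) * ρ i) {D : ℝ}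
  (hD : 0 ≤ D) (hc : ∀ k, |∫ x, g x * g (T^[k] x) ∂μ| ≤ D * ρ k)

omit [IsProbabilityMeasure μ] in
include h0 hs hc in
theorem summable_autocorrelation : Summable fun k => ∫ x, g x * g (T^[k + 1] x) ∂μ := by
  refine Summable.of_norm_bounded (((summable_nat_add_iff 1).2 (summable_rate h0 hs)).mul_left D)
    fun k => hc (k + 1)

include hT hg h0 hs hD hc in
-- Each increment of the second moment misses the asymptotic variance by twice a tail of the
-- correlation series. These tails are summable, so the total error is bounded in `n`.
theorem abs_integral_birkhoffSum_sq_sub_le (n : ℕ) :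
    |∫ x, birkhoffSum T g n x ^ 2 ∂μ
      - n * (∫ x, g x * g x ∂μ + 2 * ∑' k, ∫ x, g x * g (T^[k + 1] x) ∂μ)|
      ≤ 2 * D * ∑' i : ℕ, ((i : ℝ) + 1) * ρ i := by
  have hsum := summable_autocorrelation h0 hs hc
  suffices h : |∫ x, birkhoffSum T g n x ^ 2 ∂μ
      - n * (∫ x, g x * g x ∂μ + 2 * ∑' k, ∫ x, g x * g (T^[k + 1] x) ∂μ)|
      ≤ 2 * D * ∑ k ∈ Finset.range n, tail ρ (k + 1) from
    h.trans (mul_le_mul_of_nonneg_left (sum_tail_le h0 hs n) (by positivity))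
  induction n with
  | zero => simp
  | succ n ih =>
    rw [integral_birkhoffSum_sq_succ hT hg, Finset.sum_range_succ]
    have h1 : |∑' k, ∫ x, g x * g (T^[k + 1] x) ∂μ
        - ∑ k ∈ Finset.range n, ∫ x, g x * g (T^[k + 1] x) ∂μ| ≤ D * tail ρ (n + 1) := by
      rw [← hsum.sum_add_tsum_nat_add n, add_sub_cancel_left, tail, ← tsum_mul_left]
      rw [← Real.norm_eq_abs]
      refine tsum_of_norm_bounded ((summable_rate_add h0 hs (n + 1)).mul_left D).hasSum fun k => ?_
      rw [show n + 1 + k = k + n + 1 by ring]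
      exact hc _
    push_cast
    rw [abs_le] at *
    constructor <;> linarith [h1.1, h1.2, ih.1, ih.2]

include hT hg h0 hs hD hc in
-- A negative value would outgrow the bounded error and make a second moment negative for large `n`.
theorem asymptotic_variance_nonneg :
    0 ≤ ∫ x, g x * g x ∂μ + 2 * ∑' k, ∫ x, g x * g (T^[k + 1] x) ∂μ := by
  by_contra! hneg
  set σ := ∫ x, g x * g x ∂μ + 2 * ∑' k, ∫ x, g x * g (T^[k + 1] x) ∂μ
  obtain ⟨n, hn⟩ := exists_nat_gt ((2 * D * ∑' i : ℕ, ((i : ℝ) + 1) * ρ i) / (-σ))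
  rw [div_lt_iff₀ (by linarith)] at hn
  have h1 := (abs_le.1 (abs_integral_birkhoffSum_sq_sub_le hT hg h0 hs hD hc n)).2
  have h2 : 0 ≤ ∫ x, birkhoffSum T g n x ^ 2 ∂μ := integral_nonneg fun x => sq_nonneg _
  linarith

include hT hg h0 hs hD hc in
-- Without linear growth the Birkhoff sums are bounded in `L²`; they are the orbit sums of `g` under
-- the Koopman operator `U`, so the Hilbert space criterion applies.
theorem exists_coboundary_of_asymptotic_variance_eq_zero
    (hσ : ∫ x, g x * g x ∂μ + 2 * ∑' k, ∫ x, g x * g (T^[k + 1] x) ∂μ = 0) :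
    ∃ G : X → ℝ, MemLp G 2 μ ∧ ∀ᵐ x ∂μ, g x = G x - G (T x) := by
  set U := (Lp.compMeasurePreservingₗᵢ ℝ (E := ℝ) (p := 2) T hT).toContinuousLinearMap with hU
  set B := 2 * D * ∑' i : ℕ, ((i : ℝ) + 1) * ρ i with hB
  have hm := fun n => (bddMeas_birkhoffSum hT hg n).memLp (μ := μ) 2
  have hS0 : (hm 0).toLp _ = 0 := by
    rw [← MemLp.toLp_zero (p := 2) (μ := μ) (MemLp.zero (ε := ℝ))]
    exact MemLp.toLp_congr _ _ (by simp)
  have hS : ∀ n, (hm (n + 1)).toLp _ = (hg.memLp (μ := μ) 2).toLp g + U ((hm n).toLp _) := by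
    intro n
    have h1 : U ((hm n).toLp _) = ((hm n).comp_measurePreserving hT).toLp _ :=
      Lp.toLp_compMeasurePreserving (hm n) hT
    rw [h1, ← MemLp.toLp_add]
    refine MemLp.toLp_congr _ _ (Filter.Eventually.of_forall fun x => ?_)
    simp [birkhoffSum_succ']
  have hSB : ∀ n, ‖(hm n).toLp _‖ ≤ √B := by
    intro n
    refine Real.le_sqrt_of_sq_le ?_
    rw [← real_inner_self_eq_norm_sq, L2.inner_def]
    have h1 := (abs_le.1 (abs_integral_birkhoffSum_sq_sub_le hT hg h0 hs hD hc n)).2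
    rw [hσ, mul_zero, sub_zero] at h1
    refine le_of_eq_of_le (integral_congr_ae ?_) h1
    filter_upwards [(hm n).coeFn_toLp] with x hx
    rw [hx]
    simp [sq]
  obtain ⟨G, hG⟩ := exists_eq_sub_of_bounded_orbit_sums U hS0 hS hSB
  refine ⟨G, Lp.memLp G, ?_⟩
  have h1 : ⇑(G - U G) =ᵐ[μ] ⇑G - ⇑(U G) := Lp.coeFn_sub _ _
  have h2 : ⇑(U G) =ᵐ[μ] G ∘ T := Lp.coeFn_compMeasurePreserving G hT
  have h3 := (hg.memLp (μ := μ) 2).coeFn_toLp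
  rw [hG] at h3
  filter_upwards [h1, h2, h3] with x e1 e2 e3
  rw [← e3, e1, Pi.sub_apply, e2, Function.comp_apply]

end Birkhoff

/-! ### The covariance matrix -/

section Covariance

variable {X : Type*} [MeasurableSpace X] {μ : Measure X} [IsProbabilityMeasure μ] {T : X → X}
  (hT : MeasurePreserving T μ μ) {d : ℕ} {f : X → EuclideanSpace ℝ (Fin d)} (hf : Measurable f)
  (hf_bdd : ∃ M : ℝ, ∀ x, ‖f x‖ ≤ M)

omit [IsProbabilityMeasure μ] in
include hT hf hf_bdd in
theorem bddMeas_iter (n : ℕ) (α : Fin d) : BddMeas fun x => iter T f n x α := by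
  obtain ⟨M, hM⟩ := hf_bdd
  refine ⟨?_, M, fun x => (PiLp.norm_apply_le (p := 2) (iter T f n x) α).trans (hM _)⟩
  have h1 : Measurable fun x => f x α := by fun_prop
  exact h1.comp (hT.measurable.iterate n)

omit [IsProbabilityMeasure μ] in
theorem covMatrix_isSymm : (covMatrix μ T f).IsSymm := by
  ext α β
  simp only [Matrix.transpose_apply, covMatrix, Matrix.of_apply, covTerm, meanTensor,
    Matrix.add_apply]
  congr 1
  · congr 1; ext x; ring
  · refine tsum_congr fun n => ?_
    rw [add_comm]
    congr 1 <;> · congr 1; ext x; ring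

variable {N : ℕ} {C₂ C₄ : ℝ} {ρ : ℕ → ℝ} (hA1 : CorrelationDecay μ T f N C₂ C₄ ρ)

omit [IsProbabilityMeasure μ] in
include hA1 in
theorem summable_corr (α β : Fin d) : Summable fun n => ∫ x, f x α * iter T f n x β ∂μ :=
  Summable.of_norm_bounded ((summable_rate hA1.rate_nonneg hA1.rate_summable).mul_left C₂)
    fun n => hA1.two α β n

omit [IsProbabilityMeasure μ] in
theorem covTerm_apply (n : ℕ) (α β : Fin d) : covTerm μ T f n α β
    = ∫ x, f x β * iter T f n x α ∂μ + ∫ x, f x α * iter T f n x β ∂μ := by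
  simp only [covTerm, meanTensor, Matrix.add_apply, Matrix.of_apply, mul_comm (f _ β)]

omit [IsProbabilityMeasure μ] in
include hA1 in
theorem summable_covTerm (α β : Fin d) : Summable fun n : ℕ => covTerm μ T f (n + 1) α β := by
  simp only [covTerm_apply]
  exact ((summable_nat_add_iff 1).2 (summable_corr hA1 β α)).add
    ((summable_nat_add_iff 1).2 (summable_corr hA1 α β))

omit [IsProbabilityMeasure μ] in
include hA1 in
theorem covMatrix_apply (α β : Fin d) : covMatrix μ T f α β = ∫ x, f x α * f x β ∂μ
    + (∑' n : ℕ, ∫ x, f x β * iter T f (n + 1) x α ∂μ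
      + ∑' n : ℕ, ∫ x, f x α * iter T f (n + 1) x β ∂μ) := by
  simp only [covMatrix, Matrix.of_apply, covTerm_apply, meanTensor]
  rw [((summable_nat_add_iff 1).2 (summable_corr hA1 β α)).tsum_add
    ((summable_nat_add_iff 1).2 (summable_corr hA1 α β))]

include hT hf hf_bdd in
theorem integral_sum_mul_sum (v : Fin d → ℝ) (k : ℕ) :
    ∫ x, (∑ α, v α * f x α) * (∑ β, v β * f (T^[k] x) β) ∂μ
      = ∑ α, ∑ β, v α * v β * ∫ x, f x α * iter T f k x β ∂μ := by
  have hb := fun n α => bddMeas_iter hT hf hf_bdd n α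
  have e : ∀ x, (∑ α, v α * f x α) * (∑ β, v β * f (T^[k] x) β)
      = ∑ α, ∑ β, v α * v β * (iter T f 0 x α * iter T f k x β) := by
    intro x
    rw [Finset.sum_mul_sum]
    refine Finset.sum_congr rfl fun α _ => Finset.sum_congr rfl fun β _ => ?_
    simp only [iter, Function.iterate_zero_apply]
    ring
  simp_rw [e]
  rw [integral_finsetSum _ fun α _ => (BddMeas.sum _ fun β _ =>
    ((hb 0 α).mul (hb k β)).const_mul (v α * v β)).integrable]
  refine Finset.sum_congr rfl fun α _ => ?_
  rw [integral_finsetSum _ fun β _ => (((hb 0 α).mul (hb k β)).const_mul (v α * v β)).integrable]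
  exact Finset.sum_congr rfl fun β _ => integral_const_mul _ _

include hT hf hf_bdd hA1 in
-- In the quadratic form the two halves of `covTerm` agree after exchanging `α` and `β`, whence the
-- factor 2. This transfers the scalar variance results to `v·f`.
theorem sum_covMatrix_eq_asymptotic_variance (v : Fin d → ℝ) :
    ∑ α, ∑ β, v α * v β * covMatrix μ T f α β
      = ∫ x, (∑ α, v α * f x α) * (∑ α, v α * f x α) ∂μ
        + 2 * ∑' k, ∫ x, (∑ α, v α * f x α) * (∑ α, v α * f (T^[k + 1] x) α) ∂μ := by
  have h0 := integral_sum_mul_sum (μ := μ) hT hf hf_bdd v 0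
  have hs := fun α β => (summable_nat_add_iff 1).2 (summable_corr hA1 α β)
  simp only [Function.iterate_zero_apply, iter] at h0
  rw [h0]
  simp_rw [integral_sum_mul_sum hT hf hf_bdd]
  rw [Summable.tsum_finsetSum fun α _ => summable_sum fun β _ => (hs α β).mul_left _]
  simp_rw [fun α => Summable.tsum_finsetSum fun β (_ : β ∈ Finset.univ) =>
    (hs α β).mul_left (v α * v β), tsum_mul_left, covMatrix_apply hA1, mul_add,
    Finset.sum_add_distrib, two_mul]
  congr 2
  rw [Finset.sum_comm]
  exact Finset.sum_congr rfl fun α _ => Finset.sum_congr rfl fun β _ => by ring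

include hT hf hf_bdd hA1 in
theorem covMatrix_posDef (hA3 : ∀ v : EuclideanSpace ℝ (Fin d), ‖v‖ = 1 →
    ¬ IsCoboundaryInDirection μ T f v) : (covMatrix μ T f).PosDef := by
  refine Matrix.PosDef.of_dotProduct_mulVec_pos ?_ fun v hv => ?_
  · have := covMatrix_isSymm (μ := μ) (T := T) (f := f)
    rwa [Matrix.IsHermitian, Matrix.conjTranspose_eq_transpose_of_trivial]
  have hval : dotProduct (star v) ((covMatrix μ T f).mulVec v)
      = ∑ α, ∑ β, v α * v β * covMatrix μ T f α β := by
    simp only [dotProduct, Matrix.mulVec, Finset.mul_sum, star_trivial]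
    exact Finset.sum_congr rfl fun α _ => Finset.sum_congr rfl fun β _ => by ring
  have hg : BddMeas fun x => ∑ α, v α * f x α := BddMeas.sum _ fun α _ =>
    (bddMeas_iter hT hf hf_bdd 0 α).const_mul _
  set D := ∑ α, ∑ β, |v α| * |v β| * C₂ with hD
  have hD0 : 0 ≤ D := Finset.sum_nonneg fun α _ => Finset.sum_nonneg fun β _ =>
    mul_nonneg (by positivity) hA1.C₂_pos.le
  have hc : ∀ k, |∫ x, (∑ α, v α * f x α) * (∑ α, v α * f (T^[k] x) α) ∂μ| ≤ D * ρ k := by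
    intro k
    rw [integral_sum_mul_sum hT hf hf_bdd, hD, Finset.sum_mul]
    refine (Finset.abs_sum_le_sum_abs _ _).trans (Finset.sum_le_sum fun α _ => ?_)
    rw [Finset.sum_mul]
    refine (Finset.abs_sum_le_sum_abs _ _).trans (Finset.sum_le_sum fun β _ => ?_)
    rw [abs_mul, abs_mul, mul_assoc _ C₂]
    exact mul_le_mul_of_nonneg_left (hA1.two α β k) (by positivity)
  have hnn := asymptotic_variance_nonneg hT hg hA1.rate_nonneg hA1.rate_summable hD0 hc
  rw [hval, sum_covMatrix_eq_asymptotic_variance hT hf hf_bdd hA1]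
  refine hnn.lt_of_ne fun h0 => ?_
  obtain ⟨G, hG, hGe⟩ := exists_coboundary_of_asymptotic_variance_eq_zero hT hg hA1.rate_nonneg
    hA1.rate_summable hD0 hc h0.symm
  have hw : WithLp.toLp 2 v ≠ 0 := by simpa using hv
  -- (A3) speaks of unit vectors only, so both the direction and the transfer function are rescaled.
  refine hA3 (‖WithLp.toLp 2 v‖⁻¹ • WithLp.toLp 2 v) (norm_smul_inv_norm hw)
    ⟨fun x => ‖WithLp.toLp 2 v‖⁻¹ * G x, hG.const_mul _, ?_⟩
  filter_upwards [hGe] with x hx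
  rw [← mul_sub, ← hx, real_inner_smul_left, PiLp.inner_apply]
  simp [mul_comm]

end Covariance

/-! ### Sums over windows -/

/-- The distance between two natural numbers. -/
def gap (n m : ℕ) : ℕ := n - m + (m - n)

theorem gap_comm (n m : ℕ) : gap n m = gap m n := by unfold gap; omega

theorem mem_window {N K n m : ℕ} : m ∈ window N K n ↔ m < N ∧ gap n m ≤ K := by
  simp only [window, Finset.mem_filter, Finset.mem_range, gap]
  refine and_congr_right fun _ => ?_
  rw [abs_le]
  omega

theorem card_window_le (N K n : ℕ) : ((window N K n).card : ℝ) ≤ 2 * K + 1 := by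
  have h1 : window N K n ⊆ Finset.Icc (n - K) (n + K) := fun m hm => by
    have := (mem_window.1 hm).2
    unfold gap at this
    rw [Finset.mem_Icc]
    omega
  have h2 := Finset.card_le_card h1
  rw [Nat.card_Icc] at h2
  have h3 : (window N K n).card ≤ 2 * K + 1 := by omega
  exact_mod_cast h3

section WindowSums

variable {ρ : ℕ → ℝ} (h0 : ∀ i, 0 ≤ ρ i) (hs : Summable fun i : ℕ => (i : ℝ) * ρ i)

include h0 hs in
-- On either side of `n` the map `m ↦ gap n m - L` is injective, `hL` keeping the truncated
-- subtraction exact; so each side contributes at most the full sum of `ρ`.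
theorem sum_rate_gap_sub_le (L n : ℕ) (s : Finset ℕ) (hL : ∀ m ∈ s, L ≤ gap n m) :
    ∑ m ∈ s, ρ (gap n m - L) ≤ 2 * tail ρ 0 := by
  rw [← Finset.sum_filter_add_sum_filter_not s (fun m => n ≤ m), two_mul]
  refine add_le_add ?_ ?_
  · rw [← Finset.sum_image (s := s.filter fun m => n ≤ m) (g := fun m => gap n m - L)]
    · exact sum_le_tail h0 hs 0 _ fun _ _ => Nat.zero_le _
    · intro a ha b hb hab
      simp only [Finset.coe_filter, Set.mem_ofPred_eq] at ha hb
      have h1 := hL a ha.1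
      have h2 := hL b hb.1
      simp only [gap] at h1 h2 hab
      omega
  · rw [← Finset.sum_image (s := s.filter fun m => ¬ n ≤ m) (g := fun m => gap n m - L)]
    · exact sum_le_tail h0 hs 0 _ fun _ _ => Nat.zero_le _
    · intro a ha b hb hab
      simp only [Finset.coe_filter, Set.mem_ofPred_eq] at ha hb
      have h1 := hL a ha.1
      have h2 := hL b hb.1
      simp only [gap] at h1 h2 hab
      omega

include h0 hs in
theorem sum_rate_gap_le (n : ℕ) (s : Finset ℕ) : ∑ m ∈ s, ρ (gap n m) ≤ 2 * tail ρ 0 :=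
  sum_rate_gap_sub_le h0 hs 0 n s fun _ _ => Nat.zero_le _

theorem sum_window_const_le (N K n : ℕ) {c : ℝ} (hc : 0 ≤ c) :
    ∑ _m ∈ window N K n, c ≤ (2 * K + 1) * c := by
  rw [Finset.sum_const, nsmul_eq_mul]
  exact mul_le_mul_of_nonneg_right (card_window_le N K n) hc

theorem sum_window_le (N K n : ℕ) {F : ℕ → ℝ} {c : ℝ} (hc : 0 ≤ c)
    (hF : ∀ m ∈ window N K n, F m ≤ c) : ∑ m ∈ window N K n, F m ≤ (2 * K + 1) * c :=
  (Finset.sum_le_sum hF).trans (sum_window_const_le N K n hc)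

include h0 hs in
theorem sum_sum_window_rate_gap_le (N K n : ℕ) :
    ∑ n' ∈ Finset.range N, ∑ m' ∈ window N K n', ρ (gap n m') ≤ (2 * K + 1) * (2 * tail ρ 0) := by
  rw [Finset.sum_comm' (t' := Finset.range N) (s' := fun m' => window N K m')]
  · calc _ ≤ ∑ m' ∈ Finset.range N, (2 * (K : ℝ) + 1) * ρ (gap n m') :=
          Finset.sum_le_sum fun m' _ => sum_window_const_le N K m' (h0 _)
      _ ≤ _ := by
        rw [← Finset.mul_sum]
        exact mul_le_mul_of_nonneg_left (sum_rate_gap_le h0 hs n _) (by positivity)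
  · intro x y
    simp only [mem_window, Finset.mem_range, gap_comm x y]
    tauto

include h0 hs in
/-- Summation of a four-point kernel that decays like `ρ` in the distances between its points. -/
theorem sum_window_kernel_le {N K : ℕ} {κ : ℕ → ℕ → ℕ → ℕ → ℝ} {a : ℝ} (ha : 0 ≤ a)
    (hnear : ∀ n < N, ∀ m < N, ∀ n' < N, ∀ m' < N,
      κ n m n' m' ≤ a * (2 * ρ (gap n m) + ρ (gap n n') + ρ (gap n m')))
    (hfar : ∀ n < N, ∀ m ∈ window N K n, ∀ n' < N, ∀ m' ∈ window N K n', 2 * K ≤ gap n n' →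
      κ n m n' m' ≤ a * ρ (gap n n' - 2 * K)) :
    ∑ n ∈ Finset.range N, ∑ m ∈ window N K n, ∑ n' ∈ Finset.range N, ∑ m' ∈ window N K n',
      κ n m n' m' ≤ N * (a * (56 * tail ρ 0 * ((K : ℝ) + 1) ^ 2)) := by
  have hr := tail_nonneg h0 0
  set r := tail ρ 0 with hrdef
  have hw : ∀ {n m : ℕ}, m ∈ window N K n → m < N := fun h => (mem_window.1 h).1
  suffices h : ∀ n ∈ Finset.range N, ∑ m ∈ window N K n, ∑ n' ∈ Finset.range N,
      ∑ m' ∈ window N K n', κ n m n' m' ≤ a * (56 * r * ((K : ℝ) + 1) ^ 2) by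
    refine (Finset.sum_le_sum h).trans ?_
    simp
  intro n hn
  have hnN := Finset.mem_range.1 hn
  have hinner : ∀ m ∈ window N K n, ∑ n' ∈ Finset.range N, ∑ m' ∈ window N K n', κ n m n' m'
      ≤ a * ((4 * K + 1) * ((2 * K + 1) * (2 * ρ (gap n m))) + (2 * K + 1) * (2 * r)
        + (2 * K + 1) * (2 * r) + (2 * K + 1) * (2 * r)) := by
    intro m hm
    -- Two windows of radius `K` can interlace only if their centres are within `2K`. Those centres
    -- form a window of radius `2K`, with at most `4K + 1` elements.
    rw [← Finset.sum_filter_add_sum_filter_not _ (fun n' => gap n n' ≤ 2 * K), mul_add, mul_add,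
      mul_add]
    refine add_le_add ?_ ?_
    · calc _ ≤ ∑ n' ∈ (Finset.range N).filter (fun n' => gap n n' ≤ 2 * K),
            ∑ m' ∈ window N K n', a * (2 * ρ (gap n m) + ρ (gap n n') + ρ (gap n m')) :=
            Finset.sum_le_sum fun n' hn' => Finset.sum_le_sum fun m' hm' =>
              hnear n hnN m (hw hm) n' (Finset.mem_range.1 (Finset.mem_filter.1 hn').1) m' (hw hm')
        _ = a * (∑ n' ∈ (Finset.range N).filter (fun n' => gap n n' ≤ 2 * K),
              ∑ m' ∈ window N K n', 2 * ρ (gap n m))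
            + a * (∑ n' ∈ (Finset.range N).filter (fun n' => gap n n' ≤ 2 * K),
              ∑ m' ∈ window N K n', ρ (gap n n'))
            + a * (∑ n' ∈ (Finset.range N).filter (fun n' => gap n n' ≤ 2 * K),
              ∑ m' ∈ window N K n', ρ (gap n m')) := by
            simp only [← Finset.mul_sum, Finset.sum_add_distrib, mul_add]
        _ ≤ _ := by
          refine add_le_add (add_le_add ?_ ?_) ?_ <;> refine mul_le_mul_of_nonneg_left ?_ ha
          · have e : (Finset.range N).filter (fun n' => gap n n' ≤ 2 * K) = window N (2 * K) n := by
              ext n'; simp [mem_window]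
            rw [e]
            have := sum_window_le N (2 * K) n
              (F := fun n' => ∑ m' ∈ window N K n', 2 * ρ (gap n m))
              (c := (2 * K + 1) * (2 * ρ (gap n m))) (mul_nonneg (by positivity)
                (mul_nonneg two_pos.le (h0 _)))
              fun n' _ => sum_window_const_le N K n' (mul_nonneg two_pos.le (h0 _))
            refine this.trans (le_of_eq ?_)
            push_cast
            ring
          · calc _ ≤ ∑ n' ∈ (Finset.range N).filter (fun n' => gap n n' ≤ 2 * K),
                  (2 * (K : ℝ) + 1) * ρ (gap n n') :=
                  Finset.sum_le_sum fun n' _ => sum_window_const_le N K n' (h0 _)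
              _ ≤ _ := by
                rw [← Finset.mul_sum]
                exact mul_le_mul_of_nonneg_left (sum_rate_gap_le h0 hs n _) (by positivity)
          · refine (Finset.sum_le_sum_of_subset_of_nonneg (Finset.filter_subset _ _)
              fun n' _ _ => Finset.sum_nonneg fun m' _ => h0 _).trans ?_
            exact sum_sum_window_rate_gap_le h0 hs N K n
    · calc _ ≤ ∑ n' ∈ (Finset.range N).filter (fun n' => ¬ gap n n' ≤ 2 * K),
            (2 * (K : ℝ) + 1) * (a * ρ (gap n n' - 2 * K)) := by
            refine Finset.sum_le_sum fun n' hn' => ?_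
            rw [Finset.mem_filter, Finset.mem_range] at hn'
            exact sum_window_le N K n' (mul_nonneg ha (h0 _)) fun m' hm' =>
              hfar n hnN m hm n' hn'.1 m' hm' (by omega)
        _ = a * ((2 * (K : ℝ) + 1) *
              ∑ n' ∈ (Finset.range N).filter (fun n' => ¬ gap n n' ≤ 2 * K),
                ρ (gap n n' - 2 * K)) := by
            rw [Finset.mul_sum, Finset.mul_sum]
            exact Finset.sum_congr rfl fun _ _ => by ring
        _ ≤ _ := by
            refine mul_le_mul_of_nonneg_left (mul_le_mul_of_nonneg_left ?_ (by positivity)) ha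
            refine sum_rate_gap_sub_le h0 hs _ n _ fun n' hn' => ?_
            have := (Finset.mem_filter.1 hn').2
            omega
  refine (Finset.sum_le_sum hinner).trans ?_
  rw [← Finset.mul_sum]
  refine mul_le_mul_of_nonneg_left ?_ ha
  simp only [Finset.sum_add_distrib, ← Finset.mul_sum]
  have h1 := sum_rate_gap_le h0 hs n (window N K n)
  have h2 := sum_window_const_le N K n (c := 2 * r) (by positivity)
  have hK : (0 : ℝ) ≤ K := Nat.cast_nonneg K
  have h3 : (4 * (K : ℝ) + 1) * ((2 * K + 1) * (2 * ∑ m ∈ window N K n, ρ (gap n m)))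
      ≤ (4 * (K : ℝ) + 1) * ((2 * K + 1) * (2 * (2 * r))) := by gcongr
  have h4 : (2 * (K : ℝ) + 1) * ∑ _m ∈ window N K n, 2 * r
      ≤ (2 * K + 1) * ((2 * K + 1) * (2 * r)) := by gcongr
  simp only [Finset.mul_sum] at h3 h4 ⊢
  have h5 : 0 ≤ r * K := by positivity
  -- With `4K+1 ≤ 4(K+1)` and `2K+1 ≤ 2(K+1)`, the first near term gives `32 r (K+1)²` and the other
  -- three terms `8 r (K+1)²` each: 56 in total.
  nlinarith [mul_nonneg h5 hK]

end WindowSums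

/-! ### Moments of orders two and four -/

section Moments

variable {X : Type*} [MeasurableSpace X] {d : ℕ}

/-- The second-order moment of two coordinates at two times. -/
noncomputable def mom₂ (μ : Measure X) (T : X → X) (f : X → EuclideanSpace ℝ (Fin d))
    (p q : ℕ × Fin d) : ℝ :=
  ∫ x, iter T f p.1 x p.2 * iter T f q.1 x q.2 ∂μ

/-- The fourth-order moment of four coordinates at four times. -/
noncomputable def mom₄ (μ : Measure X) (T : X → X) (f : X → EuclideanSpace ℝ (Fin d))
    (p q r s : ℕ × Fin d) : ℝ :=
  ∫ x, iter T f p.1 x p.2 * iter T f q.1 x q.2 * iter T f r.1 x r.2 * iter T f s.1 x s.2 ∂μ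

variable {μ : Measure X} [IsProbabilityMeasure μ] {T : X → X}
  (hT : MeasurePreserving T μ μ) {f : X → EuclideanSpace ℝ (Fin d)} (hf : Measurable f)
  (hf_bdd : ∃ M : ℝ, ∀ x, ‖f x‖ ≤ M)

omit [IsProbabilityMeasure μ] in
theorem mom₂_comm (p q : ℕ × Fin d) : mom₂ μ T f p q = mom₂ μ T f q p := by
  simp only [mom₂, mul_comm]

omit [MeasurableSpace X] in
theorem iter_add (n k : ℕ) (x : X) : iter T f (n + k) x = iter T f n (T^[k] x) := by
  simp only [iter, Function.iterate_add_apply]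

omit [IsProbabilityMeasure μ] in
include hT hf hf_bdd in
theorem mom₂_add (p q : ℕ × Fin d) (k : ℕ) :
    mom₂ μ T f (p.1 + k, p.2) (q.1 + k, q.2) = mom₂ μ T f p q := by
  have hb := fun n α => bddMeas_iter hT hf hf_bdd n α
  have := integral_comp_measurePreserving (hT.iterate k) ((hb p.1 p.2).mul (hb q.1 q.2)).1
  rw [mom₂, mom₂, ← this]
  simp only [iter_add]

omit [IsProbabilityMeasure μ] in
include hT hf hf_bdd in
theorem mom₄_add (p q r s : ℕ × Fin d) (k : ℕ) :
    mom₄ μ T f (p.1 + k, p.2) (q.1 + k, q.2) (r.1 + k, r.2) (s.1 + k, s.2)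
      = mom₄ μ T f p q r s := by
  have hb := fun n α => bddMeas_iter hT hf hf_bdd n α
  have := integral_comp_measurePreserving (hT.iterate k)
    ((((hb p.1 p.2).mul (hb q.1 q.2)).mul (hb r.1 r.2)).mul (hb s.1 s.2)).1
  rw [mom₄, mom₄, ← this]
  simp only [iter_add]

variable {N : ℕ} {C₂ C₄ : ℝ} {ρ : ℕ → ℝ} (hA1 : CorrelationDecay μ T f N C₂ C₄ ρ)

omit [IsProbabilityMeasure μ] in
include hT hf hf_bdd in
theorem mom₂_eq {n m : ℕ} (hnm : n ≤ m) (α β : Fin d) :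
    mom₂ μ T f (n, α) (m, β) = ∫ x, f x α * iter T f (m - n) x β ∂μ := by
  have := mom₂_add (μ := μ) hT hf hf_bdd (0, α) (m - n, β) n
  simp only [zero_add, Nat.sub_add_cancel hnm] at this
  rw [this]
  rfl

omit [IsProbabilityMeasure μ] in
include hT hf hf_bdd hA1 in
theorem abs_mom₂_le (p q : ℕ × Fin d) : |mom₂ μ T f p q| ≤ C₂ * ρ (gap p.1 q.1) := by
  obtain ⟨n, α⟩ := p
  obtain ⟨m, β⟩ := q
  rcases le_total n m with h | h
  · rw [mom₂_eq hT hf hf_bdd h, gap, Nat.sub_eq_zero_of_le h, zero_add]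
    exact hA1.two _ _ _
  · rw [mom₂_comm, mom₂_eq hT hf hf_bdd h, gap, Nat.sub_eq_zero_of_le h, add_zero]
    exact hA1.two _ _ _

variable {α β : Fin d}

omit [IsProbabilityMeasure μ] in
include hT hf hf_bdd hA1 in
-- Invariance shifts the earliest time to 0, the form in which correlation decay is assumed.
theorem abs_mom₄_le_of_sorted {p q r s : ℕ × Fin d} (hp : p.2 ∈ ({α, β} : Set (Fin d)))
    (hq : q.2 ∈ ({α, β} : Set (Fin d))) (hr : r.2 ∈ ({α, β} : Set (Fin d)))
    (hs : s.2 ∈ ({α, β} : Set (Fin d))) (hpq : p.1 ≤ q.1) (hqr : q.1 ≤ r.1) (hrs : r.1 ≤ s.1)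
    (hsN : s.1 < N) :
    |mom₄ μ T f p q r s| ≤ C₄ * min (ρ (q.1 - p.1)) (ρ (s.1 - r.1)) := by
  have h := mom₄_add (μ := μ) hT hf hf_bdd (0, p.2) (q.1 - p.1, q.2) (r.1 - p.1, r.2)
    (s.1 - p.1, s.2) p.1
  simp only [zero_add, Nat.sub_add_cancel hpq, Nat.sub_add_cancel (hpq.trans hqr),
    Nat.sub_add_cancel (hpq.trans (hqr.trans hrs))] at h
  have h2 := hA1.four α β p.2 hp q.2 hq r.2 hr s.2 hs (q.1 - p.1) (r.1 - p.1) (s.1 - p.1)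
    (by omega) (by omega) (by omega)
  rw [show s.1 - p.1 - (r.1 - p.1) = s.1 - r.1 by omega] at h2
  rw [h]
  exact h2

omit [IsProbabilityMeasure μ] in
include hT hf hf_bdd hA1 in
theorem abs_mom₄_sub_le_of_sorted {p q r s : ℕ × Fin d} (hp : p.2 ∈ ({α, β} : Set (Fin d)))
    (hq : q.2 ∈ ({α, β} : Set (Fin d))) (hr : r.2 ∈ ({α, β} : Set (Fin d)))
    (hs : s.2 ∈ ({α, β} : Set (Fin d))) (hpq : p.1 ≤ q.1) (hqr : q.1 ≤ r.1) (hrs : r.1 ≤ s.1)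
    (hsN : s.1 < N) :
    |mom₄ μ T f p q r s - mom₂ μ T f p q * mom₂ μ T f r s| ≤ C₄ * ρ (r.1 - q.1) := by
  have h := mom₄_add (μ := μ) hT hf hf_bdd (0, p.2) (q.1 - p.1, q.2) (r.1 - p.1, r.2)
    (s.1 - p.1, s.2) p.1
  have h' := mom₂_add (μ := μ) hT hf hf_bdd (0, p.2) (q.1 - p.1, q.2) p.1
  have h'' := mom₂_add (μ := μ) hT hf hf_bdd (r.1 - p.1, r.2) (s.1 - p.1, s.2) p.1
  simp only [zero_add, Nat.sub_add_cancel hpq, Nat.sub_add_cancel (hpq.trans hqr),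
    Nat.sub_add_cancel (hpq.trans (hqr.trans hrs))] at h h' h''
  have h2 := hA1.four_sub α β p.2 hp q.2 hq r.2 hr s.2 hs (q.1 - p.1) (r.1 - p.1) (s.1 - p.1)
    (by omega) (by omega) (by omega)
  rw [show r.1 - p.1 - (q.1 - p.1) = r.1 - q.1 by omega] at h2
  rw [h, h', h'']
  exact h2

omit [IsProbabilityMeasure μ] in
theorem mom₄_swap₁₂ (p q r s : ℕ × Fin d) : mom₄ μ T f p q r s = mom₄ μ T f q p r s := by
  simp only [mom₄]; congr 1; ext x; ring

omit [IsProbabilityMeasure μ] in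
theorem mom₄_swap₂₃ (p q r s : ℕ × Fin d) : mom₄ μ T f p q r s = mom₄ μ T f p r q s := by
  simp only [mom₄]; congr 1; ext x; ring

omit [IsProbabilityMeasure μ] in
theorem mom₄_swap₃₄ (p q r s : ℕ × Fin d) : mom₄ μ T f p q r s = mom₄ μ T f p q s r := by
  simp only [mom₄]; congr 1; ext x; ring

omit [IsProbabilityMeasure μ] in
include hT hf hf_bdd hA1 in
-- Once `p` is inserted among the sorted times, it is an endpoint of the first or the last gap, so
-- one of the two rates in the minimum is a rate at a distance from `p`. Adding all three rates
-- makes the bound symmetric in `q, r, s`.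
theorem abs_mom₄_le_of_sorted_tail {p q r s : ℕ × Fin d} (hp : p.2 ∈ ({α, β} : Set (Fin d)))
    (hq : q.2 ∈ ({α, β} : Set (Fin d))) (hr : r.2 ∈ ({α, β} : Set (Fin d)))
    (hs : s.2 ∈ ({α, β} : Set (Fin d))) (hqr : q.1 ≤ r.1) (hrs : r.1 ≤ s.1)
    (hpN : p.1 < N) (hsN : s.1 < N) :
    |mom₄ μ T f p q r s| ≤ C₄ * (ρ (gap p.1 q.1) + ρ (gap p.1 r.1) + ρ (gap p.1 s.1)) := by
  have h0 := hA1.rate_nonneg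
  have hC := hA1.C₄_pos.le
  rcases le_total p.1 q.1 with h1 | h1
  · refine (abs_mom₄_le_of_sorted hT hf hf_bdd hA1 hp hq hr hs h1 hqr hrs hsN).trans
      (mul_le_mul_of_nonneg_left ((min_le_left _ _).trans ?_) hC)
    rw [show q.1 - p.1 = gap p.1 q.1 by unfold gap; omega]
    linarith [h0 (gap p.1 r.1), h0 (gap p.1 s.1)]
  rw [mom₄_swap₁₂]
  rcases le_total p.1 r.1 with h2 | h2
  · refine (abs_mom₄_le_of_sorted hT hf hf_bdd hA1 hq hp hr hs h1 h2 hrs hsN).trans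
      (mul_le_mul_of_nonneg_left ((min_le_left _ _).trans ?_) hC)
    rw [show p.1 - q.1 = gap p.1 q.1 by unfold gap; omega]
    linarith [h0 (gap p.1 r.1), h0 (gap p.1 s.1)]
  rw [mom₄_swap₂₃]
  rcases le_total p.1 s.1 with h3 | h3
  · refine (abs_mom₄_le_of_sorted hT hf hf_bdd hA1 hq hr hp hs hqr h2 h3 hsN).trans
      (mul_le_mul_of_nonneg_left ((min_le_right _ _).trans ?_) hC)
    rw [show s.1 - p.1 = gap p.1 s.1 by unfold gap; omega]
    linarith [h0 (gap p.1 r.1), h0 (gap p.1 q.1)]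
  rw [mom₄_swap₃₄]
  refine (abs_mom₄_le_of_sorted hT hf hf_bdd hA1 hq hr hs hp hqr hrs h3 hpN).trans
    (mul_le_mul_of_nonneg_left ((min_le_right _ _).trans ?_) hC)
  rw [show p.1 - s.1 = gap p.1 s.1 by unfold gap; omega]
  linarith [h0 (gap p.1 r.1), h0 (gap p.1 q.1)]

omit [IsProbabilityMeasure μ] in
include hT hf hf_bdd hA1 in
theorem abs_mom₄_le {p q r s : ℕ × Fin d} (hp : p.2 ∈ ({α, β} : Set (Fin d)))
    (hq : q.2 ∈ ({α, β} : Set (Fin d))) (hr : r.2 ∈ ({α, β} : Set (Fin d)))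
    (hs : s.2 ∈ ({α, β} : Set (Fin d))) (hpN : p.1 < N) (hqN : q.1 < N) (hrN : r.1 < N)
    (hsN : s.1 < N) :
    |mom₄ μ T f p q r s| ≤ C₄ * (ρ (gap p.1 q.1) + ρ (gap p.1 r.1) + ρ (gap p.1 s.1)) := by
  have key := fun {q r s : ℕ × Fin d} hq hr hs hqr hrs hsN =>
    abs_mom₄_le_of_sorted_tail (q := q) (r := r) (s := s) hT hf hf_bdd hA1 hp hq hr hs hqr hrs
      hpN hsN
  -- By symmetry of the bound the last three times may be sorted. Three comparisons give eight cases
  -- for six orders; the two cyclic ones occur only with ties.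
  rcases le_total q.1 r.1 with h1 | h1 <;> rcases le_total r.1 s.1 with h2 | h2 <;>
    rcases le_total q.1 s.1 with h3 | h3
  · exact key hq hr hs h1 h2 hsN
  · exact key hq hr hs h1 h2 hsN
  · have := key hq hs hr h3 h2 hrN
    rw [mom₄_swap₃₄]; linarith
  · have := key hs hq hr h3 h1 hrN
    rw [mom₄_swap₃₄, mom₄_swap₂₃]; linarith
  · have := key hr hq hs h1 h3 hsN
    rw [mom₄_swap₂₃]; linarith
  · have := key hr hs hq h2 h3 hqN
    rw [mom₄_swap₂₃, mom₄_swap₃₄]; linarith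
  · have := key hs hr hq h2 h1 hqN
    rw [mom₄_swap₂₃, mom₄_swap₃₄, mom₄_swap₂₃]; linarith
  · have := key hs hr hq h2 h1 hqN
    rw [mom₄_swap₂₃, mom₄_swap₃₄, mom₄_swap₂₃]; linarith

omit [IsProbabilityMeasure μ] in
include hT hf hf_bdd hA1 in
-- Only the distance between the pairs `{p, q}` and `{r, s}` matters: each pair can be sorted
-- internally, and monotonicity of `ρ` replaces the true distance by `g`.
theorem abs_mom₄_sub_le_of_separated {p q r s : ℕ × Fin d} (hp : p.2 ∈ ({α, β} : Set (Fin d)))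
    (hq : q.2 ∈ ({α, β} : Set (Fin d))) (hr : r.2 ∈ ({α, β} : Set (Fin d)))
    (hs : s.2 ∈ ({α, β} : Set (Fin d))) (hrN : r.1 < N) (hsN : s.1 < N) {g : ℕ}
    (hpr : p.1 + g ≤ r.1) (hps : p.1 + g ≤ s.1) (hqr : q.1 + g ≤ r.1) (hqs : q.1 + g ≤ s.1) :
    |mom₄ μ T f p q r s - mom₂ μ T f p q * mom₂ μ T f r s| ≤ C₄ * ρ g := by
  have hC := hA1.C₄_pos.le
  have key : ∀ {p q r s : ℕ × Fin d}, p.2 ∈ ({α, β} : Set (Fin d)) →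
      q.2 ∈ ({α, β} : Set (Fin d)) → r.2 ∈ ({α, β} : Set (Fin d)) →
      s.2 ∈ ({α, β} : Set (Fin d)) → p.1 ≤ q.1 → q.1 + g ≤ r.1 → r.1 ≤ s.1 → s.1 < N →
      |mom₄ μ T f p q r s - mom₂ μ T f p q * mom₂ μ T f r s| ≤ C₄ * ρ g :=
    fun hp hq hr hs h1 h2 h3 h4 =>
      (abs_mom₄_sub_le_of_sorted hT hf hf_bdd hA1 hp hq hr hs h1 (by omega) h3 h4).trans
        (mul_le_mul_of_nonneg_left (hA1.rate_antitone (by omega)) hC)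
  rcases le_total p.1 q.1 with h1 | h1 <;> rcases le_total r.1 s.1 with h2 | h2
  · exact key hp hq hr hs h1 hqr h2 hsN
  · rw [mom₄_swap₃₄, mom₂_comm r]
    exact key hp hq hs hr h1 hqs h2 hrN
  · rw [mom₄_swap₁₂, mom₂_comm p]
    exact key hq hp hr hs h1 hpr h2 hsN
  · rw [mom₄_swap₁₂, mom₄_swap₃₄, mom₂_comm p, mom₂_comm r]
    exact key hq hp hs hr h1 hps h2 hrN

end Moments

/-! ### Concentration of the windowed covariation -/

/-- Integrate the pointwise inequality `|g| ≤ g²/(2c) + c/2`. -/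
theorem integral_abs_le_of_integral_sq_le {X : Type*} [MeasurableSpace X] {μ : Measure X}
    [IsProbabilityMeasure μ] {g : X → ℝ} (hg : BddMeas g) {c : ℝ} (hc : 0 < c)
    (h : ∫ x, g x ^ 2 ∂μ ≤ c ^ 2) : ∫ x, |g x| ∂μ ≤ c := by
  have h1 : ∫ x, |g x| ∂μ ≤ ∫ x, ((2 * c)⁻¹ * g x ^ 2 + c / 2) ∂μ := by
    refine integral_mono hg.abs.integrable
      (((hg.pow 2).const_mul _).add (BddMeas.const _)).integrable fun x => ?_
    have h2 : (2 * c)⁻¹ * g x ^ 2 + c / 2 - |g x| = (2 * c)⁻¹ * (|g x| - c) ^ 2 := by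
      rw [← sq_abs (g x)]
      field_simp
      ring
    have h3 : 0 ≤ (2 * c)⁻¹ * (|g x| - c) ^ 2 := by positivity
    simp only
    linarith
  rw [integral_add ((hg.pow 2).const_mul _).integrable (integrable_const _),
    integral_const_mul] at h1
  simp only [integral_const, probReal_univ, smul_eq_mul, one_mul] at h1
  have h4 : (2 * c)⁻¹ * ∫ x, g x ^ 2 ∂μ ≤ (2 * c)⁻¹ * c ^ 2 :=
    mul_le_mul_of_nonneg_left h (by positivity)
  have h5 : (2 * c)⁻¹ * c ^ 2 = c / 2 := by field_simp
  linarith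

section Estimates

variable {X : Type*} [MeasurableSpace X] {d : ℕ} {μ : Measure X} [IsProbabilityMeasure μ]
  {T : X → X} (hT : MeasurePreserving T μ μ) {f : X → EuclideanSpace ℝ (Fin d)}
  (hf : Measurable f) (hf_bdd : ∃ M : ℝ, ∀ x, ‖f x‖ ≤ M)
  {N : ℕ} {C₂ C₄ : ℝ} {ρ : ℕ → ℝ} (hA1 : CorrelationDecay μ T f N C₂ C₄ ρ)

include hT hf hf_bdd hA1 in
/-- Second moments of sums over a window. -/
theorem integral_sum_window_sq_le (K n : ℕ) (α : Fin d) :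
    ∫ x, (∑ m ∈ window N K n, iter T f m x α) ^ 2 ∂μ ≤ C₂ * ((2 * K + 1) * (2 * tail ρ 0)) := by
  have hb := fun n α => bddMeas_iter hT hf hf_bdd n α
  have h0 := hA1.rate_nonneg
  have e : ∫ x, (∑ m ∈ window N K n, iter T f m x α) ^ 2 ∂μ
      = ∑ m ∈ window N K n, ∑ m' ∈ window N K n, mom₂ μ T f (m, α) (m', α) := by
    simp only [sq, Finset.sum_mul_sum]
    rw [integral_finsetSum _ fun m _ =>
      (BddMeas.sum _ fun m' _ => (hb m α).mul (hb m' α)).integrable]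
    exact Finset.sum_congr rfl fun m _ =>
      integral_finsetSum _ fun m' _ => ((hb m α).mul (hb m' α)).integrable
  rw [e]
  calc _ ≤ ∑ m ∈ window N K n, C₂ * (2 * tail ρ 0) := by
        refine Finset.sum_le_sum fun m _ => ?_
        refine (Finset.sum_le_sum fun m' _ =>
          (le_abs_self _).trans (abs_mom₂_le hT hf hf_bdd hA1 _ _)).trans ?_
        rw [← Finset.mul_sum]
        exact mul_le_mul_of_nonneg_left (sum_rate_gap_le h0 hA1.rate_summable m _) hA1.C₂_pos.le
    _ ≤ _ := by
        refine (sum_window_const_le N K n ?_).trans (le_of_eq (by ring))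
        exact mul_nonneg hA1.C₂_pos.le (mul_nonneg two_pos.le (tail_nonneg h0 0))

include hT hf hf_bdd hA1 in
theorem integral_abs_sum_window_mul_le (K n : ℕ) (α β : Fin d) :
    ∫ x, |∑ m ∈ window N K n, iter T f m x α| * |∑ m ∈ window N K n, iter T f m x β| ∂μ
      ≤ C₂ * ((2 * K + 1) * (2 * tail ρ 0)) := by
  have hS := fun α => BddMeas.sum (window N K n) fun m _ => bddMeas_iter hT hf hf_bdd m α
  have h1 := integral_sum_window_sq_le hT hf hf_bdd hA1 K n
  calc _ ≤ ∫ x, (2⁻¹ * (∑ m ∈ window N K n, iter T f m x α) ^ 2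
        + 2⁻¹ * (∑ m ∈ window N K n, iter T f m x β) ^ 2) ∂μ := by
        refine integral_mono ((hS α).abs.mul (hS β).abs).integrable
          ((((hS α).pow 2).const_mul _).add (((hS β).pow 2).const_mul _)).integrable fun x => ?_
        have := two_mul_le_add_sq |∑ m ∈ window N K n, iter T f m x α|
          |∑ m ∈ window N K n, iter T f m x β|
        simp only [sq_abs] at this
        simp only
        linarith
    _ ≤ _ := by
        rw [integral_add (((hS α).pow 2).const_mul _).integrable
          (((hS β).pow 2).const_mul _).integrable, integral_const_mul, integral_const_mul]
        linarith [h1 α, h1 β]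

/-- The windowed covariation sum of two coordinates, centred at its mean. -/
noncomputable def windowFluct (μ : Measure X) (T : X → X) (f : X → EuclideanSpace ℝ (Fin d))
    (N K : ℕ) (α β : Fin d) (x : X) : ℝ :=
  ∑ n ∈ Finset.range N, ∑ m ∈ window N K n,
    (iter T f n x α * iter T f m x β - mom₂ μ T f (n, α) (m, β))

omit [IsProbabilityMeasure μ] in
include hT hf hf_bdd in
theorem bddMeas_windowFluct (K : ℕ) (α β : Fin d) : BddMeas (windowFluct μ T f N K α β) := by
  have hb := fun n α => bddMeas_iter hT hf hf_bdd n α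
  exact BddMeas.sum _ fun n _ => BddMeas.sum _ fun m _ => ((hb n α).mul (hb m β)).sub
    (BddMeas.const _)

include hT hf hf_bdd in
theorem integral_windowFluct_sq (K : ℕ) (α β : Fin d) :
    ∫ x, windowFluct μ T f N K α β x ^ 2 ∂μ
      = ∑ n ∈ Finset.range N, ∑ m ∈ window N K n, ∑ n' ∈ Finset.range N, ∑ m' ∈ window N K n',
        (mom₄ μ T f (n, α) (m, β) (n', α) (m', β)
          - mom₂ μ T f (n, α) (m, β) * mom₂ μ T f (n', α) (m', β)) := by
  have hb := fun n α => bddMeas_iter hT hf hf_bdd n α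
  have hD : ∀ n m, BddMeas fun x =>
      iter T f n x α * iter T f m x β - mom₂ μ T f (n, α) (m, β) := fun n m =>
    ((hb n α).mul (hb m β)).sub (BddMeas.const _)
  simp only [windowFluct, sq, Finset.sum_mul]
  simp only [Finset.mul_sum]
  rw [integral_finsetSum _ fun n _ => (BddMeas.sum _ fun m _ => BddMeas.sum _ fun n' _ =>
    BddMeas.sum _ fun m' _ => (hD n m).mul (hD n' m')).integrable]
  refine Finset.sum_congr rfl fun n _ => ?_
  rw [integral_finsetSum _ fun m _ => (BddMeas.sum _ fun n' _ =>
    BddMeas.sum _ fun m' _ => (hD n m).mul (hD n' m')).integrable]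
  refine Finset.sum_congr rfl fun m _ => ?_
  rw [integral_finsetSum _ fun n' _ =>
    (BddMeas.sum _ fun m' _ => (hD n m).mul (hD n' m')).integrable]
  refine Finset.sum_congr rfl fun n' _ => ?_
  rw [integral_finsetSum _ fun m' _ => ((hD n m).mul (hD n' m')).integrable]
  refine Finset.sum_congr rfl fun m' _ => ?_
  have h1 := (hb n α).mul (hb m β)
  have h2 := (hb n' α).mul (hb m' β)
  have e : ∀ x, (iter T f n x α * iter T f m x β - mom₂ μ T f (n, α) (m, β))
      * (iter T f n' x α * iter T f m' x β - mom₂ μ T f (n', α) (m', β))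
      = iter T f n x α * iter T f m x β * (iter T f n' x α * iter T f m' x β)
        - mom₂ μ T f (n', α) (m', β) * (iter T f n x α * iter T f m x β)
        - mom₂ μ T f (n, α) (m, β) * (iter T f n' x α * iter T f m' x β)
        + mom₂ μ T f (n, α) (m, β) * mom₂ μ T f (n', α) (m', β) := fun x => by ring
  simp_rw [e]
  rw [integral_add (((h1.mul h2).sub (h1.const_mul _)).sub (h2.const_mul _)).integrable
      (integrable_const _),
    integral_sub ((h1.mul h2).sub (h1.const_mul _)).integrable (h2.const_mul _).integrable,
    integral_sub (h1.mul h2).integrable (h1.const_mul _).integrable, integral_const_mul,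
    integral_const_mul]
  have e1 : ∫ x, iter T f n x α * iter T f m x β ∂μ = mom₂ μ T f (n, α) (m, β) := rfl
  have e2 : ∫ x, iter T f n' x α * iter T f m' x β ∂μ = mom₂ μ T f (n', α) (m', β) := rfl
  have e3 : ∫ x, iter T f n x α * iter T f m x β * (iter T f n' x α * iter T f m' x β) ∂μ
      = mom₄ μ T f (n, α) (m, β) (n', α) (m', β) := by
    simp only [mom₄, mul_assoc]
  rw [e1, e2, e3]
  simp only [integral_const, probReal_univ, smul_eq_mul, one_mul]
  ring

include hT hf hf_bdd hA1 in
-- The variance is a sum of covariances of products of pairs. For centres at least `2K` apart the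
-- pairs are separated by at least `gap n n' - 2K` and the covariances decay; otherwise the fourth
-- moment and the product of second moments are bounded separately. Working with `C ≥ max(C₂, √C₄)`
-- puts both under the single factor `C²`.
theorem integral_windowFluct_sq_le (K : ℕ) (α β : Fin d) {C : ℝ} (hC₂ : C₂ ≤ C)
    (hC₄ : √C₄ ≤ C) :
    ∫ x, windowFluct μ T f N K α β x ^ 2 ∂μ
      ≤ N * (C ^ 2 * (56 * tail ρ 0 * ((K : ℝ) + 1) ^ 2)) := by
  have h0 := hA1.rate_nonneg
  have hα : α ∈ ({α, β} : Set (Fin d)) := by simp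
  have hβ : β ∈ ({α, β} : Set (Fin d)) := by simp
  have hC4 : C₄ ≤ C ^ 2 := (Real.sqrt_le_left ((Real.sqrt_nonneg _).trans hC₄)).1 hC₄
  have hC2 : C₂ * C₂ ≤ C ^ 2 := by
    rw [sq]; exact mul_self_le_mul_self hA1.C₂_pos.le hC₂
  rw [integral_windowFluct_sq hT hf hf_bdd]
  refine sum_window_kernel_le h0 hA1.rate_summable (sq_nonneg C) ?_ ?_
  · intro n hn m hm n' hn' m' hm'
    have h1 := abs_mom₄_le hT hf hf_bdd hA1 (p := (n, α)) (q := (m, β)) (r := (n', α))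
      (s := (m', β)) hα hβ hα hβ hn hm hn' hm'
    have h2 := abs_mom₂_le hT hf hf_bdd hA1 (n, α) (m, β)
    have h3 := abs_mom₂_le hT hf hf_bdd hA1 (n', α) (m', β)
    have h4 : |mom₂ μ T f (n', α) (m', β)| ≤ C₂ := by
      refine h3.trans (mul_le_of_le_one_right hA1.C₂_pos.le ?_)
      rw [← hA1.rate_zero]
      exact hA1.rate_antitone (Nat.zero_le _)
    have h5 : |mom₂ μ T f (n, α) (m, β) * mom₂ μ T f (n', α) (m', β)|
        ≤ C ^ 2 * ρ (gap n m) := by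
      rw [abs_mul]
      calc _ ≤ C₂ * ρ (gap n m) * C₂ := mul_le_mul h2 h4 (abs_nonneg _)
            (mul_nonneg hA1.C₂_pos.le (h0 _))
        _ = C₂ * C₂ * ρ (gap n m) := by ring
        _ ≤ _ := mul_le_mul_of_nonneg_right hC2 (h0 _)
    have h6 : C₄ * (ρ (gap n m) + ρ (gap n n') + ρ (gap n m'))
        ≤ C ^ 2 * (ρ (gap n m) + ρ (gap n n') + ρ (gap n m')) :=
      mul_le_mul_of_nonneg_right hC4 (add_nonneg (add_nonneg (h0 _) (h0 _)) (h0 _))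
    simp only at h1
    linarith [(abs_le.1 h1).2, (abs_le.1 h5).1]
  · intro n hn m hm n' hn' m' hm' hfar
    rw [mem_window] at hm hm'
    obtain ⟨hm, hnm⟩ := hm
    obtain ⟨hm', hnm'⟩ := hm'
    have h6 : C₄ * ρ (gap n n' - 2 * K) ≤ C ^ 2 * ρ (gap n n' - 2 * K) :=
      mul_le_mul_of_nonneg_right hC4 (h0 _)
    refine le_trans ?_ h6
    simp only [gap] at hnm hnm' hfar ⊢
    rcases le_total n n' with h | h
    · refine (le_abs_self _).trans (abs_mom₄_sub_le_of_separated hT hf hf_bdd hA1 hα hβ hα hβ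
        hn' hm' ?_ ?_ ?_ ?_) <;> simp only <;> omega
    · have e : mom₄ μ T f (n, α) (m, β) (n', α) (m', β)
          = mom₄ μ T f (n', α) (m', β) (n, α) (m, β) := by
        simp only [mom₄]; congr 1; ext x; ring
      rw [e, mul_comm (mom₂ μ T f (n, α) (m, β))]
      refine (le_abs_self _).trans (abs_mom₄_sub_le_of_separated hT hf hf_bdd hA1 hα hβ hα hβ
        hn hm ?_ ?_ ?_ ?_) <;> simp only <;> omega

/-- Splits a window into lags `m - n ≥ 0`, including lag 0 (hence the `+ 1`), and lags `n - m ≥ 1`,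
reindexed from 0. The minima record truncation of the window at the ends of `{0, …, N-1}`. -/
theorem sum_window_eq {K n : ℕ} (hn : n < N) (F A B : ℕ → ℝ)
    (hA : ∀ m, n ≤ m → F m = A (m - n)) (hB : ∀ m, m < n → F m = B (n - m - 1)) :
    ∑ m ∈ window N K n, F m
      = ∑ k ∈ Finset.range (min K (N - 1 - n) + 1), A k + ∑ k ∈ Finset.range (min K n), B k := by
  rw [← Finset.sum_filter_add_sum_filter_not _ (fun m => n ≤ m)]
  congr 1
  · refine Finset.sum_nbij' (fun m => m - n) (fun k => n + k) ?_ ?_ ?_ ?_ ?_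
    · intro m hm
      simp only [Finset.mem_filter, mem_window, gap, Finset.mem_range] at hm ⊢
      omega
    · intro k hk
      simp only [Finset.mem_filter, mem_window, gap, Finset.mem_range] at hk ⊢
      omega
    · intro m hm
      simp only [Finset.mem_filter] at hm
      omega
    · intro k hk
      omega
    · intro m hm
      exact hA m (Finset.mem_filter.1 hm).2
  · refine Finset.sum_nbij' (fun m => n - m - 1) (fun k => n - k - 1) ?_ ?_ ?_ ?_ ?_
    · intro m hm
      simp only [Finset.mem_filter, mem_window, gap, Finset.mem_range] at hm ⊢
      omega
    · intro k hk
      simp only [Finset.mem_filter, mem_window, gap, Finset.mem_range] at hk ⊢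
      omega
    · intro m hm
      simp only [Finset.mem_filter] at hm
      omega
    · intro k hk
      simp only [Finset.mem_range] at hk
      omega
    · intro m hm
      exact hB m (not_le.1 (Finset.mem_filter.1 hm).2)

theorem abs_tsum_sub_sum_range_le (h0 : ∀ i, 0 ≤ ρ i) (hs : Summable fun i : ℕ => (i : ℝ) * ρ i)
    {A : ℕ → ℝ} {C : ℝ} {j : ℕ} (hA : ∀ k, |A k| ≤ C * ρ (k + j)) (a : ℕ) :
    |∑' k, A k - ∑ k ∈ Finset.range a, A k| ≤ C * tail ρ (a + j) := by
  have hsum : Summable A := Summable.of_norm_bounded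
    (((summable_nat_add_iff j).2 (summable_rate h0 hs)).mul_left C) hA
  rw [← hsum.sum_add_tsum_nat_add a, add_sub_cancel_left, tail, ← tsum_mul_left, ← Real.norm_eq_abs]
  refine tsum_of_norm_bounded ((summable_rate_add h0 hs (a + j)).mul_left C).hasSum fun k => ?_
  rw [show a + j + k = k + a + j by ring]
  exact hA _

omit [IsProbabilityMeasure μ] in
include hT hf hf_bdd hA1 in
-- The windowed sum is a two-sided partial sum of the covariance series. A side is cut by `K` or by
-- an end of the time range; the tail at the smaller cut is at most the sum of the two tails.
theorem abs_sum_window_mom₂_sub_le {K n : ℕ} (hn : n < N) (α β : Fin d) :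
    |∑ m ∈ window N K n, mom₂ μ T f (n, α) (m, β) - covMatrix μ T f α β|
      ≤ C₂ * (2 * tail ρ (K + 1) + tail ρ (n + 1) + tail ρ (N - 1 - n + 1)) := by
  have h0 := hA1.rate_nonneg
  have hs := hA1.rate_summable
  rw [sum_window_eq hn _ (fun k => ∫ x, f x α * iter T f k x β ∂μ)
    (fun k => ∫ x, f x β * iter T f (k + 1) x α ∂μ)
    (fun m hm => mom₂_eq hT hf hf_bdd hm α β) ?_]
  · have hS : covMatrix μ T f α β = ∑' k, ∫ x, f x α * iter T f k x β ∂μ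
        + ∑' k, ∫ x, f x β * iter T f (k + 1) x α ∂μ := by
      rw [covMatrix_apply hA1, (summable_corr hA1 α β).tsum_eq_zero_add]
      simp only [iter, Function.iterate_zero_apply]
      ring
    have h1 := abs_tsum_sub_sum_range_le h0 hs (j := 0) (fun k => hA1.two α β k)
      (min K (N - 1 - n) + 1)
    have h2 := abs_tsum_sub_sum_range_le h0 hs (j := 1) (fun k => hA1.two β α (k + 1)) (min K n)
    have hmin : ∀ a b, tail ρ (min a b + 1) ≤ tail ρ (a + 1) + tail ρ (b + 1) := by
      intro a b
      rcases min_choice a b with h | h <;> rw [h]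
      · linarith [tail_nonneg h0 (b + 1)]
      · linarith [tail_nonneg h0 (a + 1)]
    have h3 := mul_le_mul_of_nonneg_left (hmin K (N - 1 - n)) hA1.C₂_pos.le
    have h4 := mul_le_mul_of_nonneg_left (hmin K n) hA1.C₂_pos.le
    rw [hS]
    rw [add_zero] at h1
    rw [abs_le] at h1 h2 ⊢
    constructor <;> linarith [h1.1, h1.2, h2.1, h2.2]
  · intro m hm
    simp only
    rw [mom₂_comm, mom₂_eq hT hf hf_bdd hm.le, show n - m - 1 + 1 = n - m by omega]

omit [IsProbabilityMeasure μ] in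
include hT hf hf_bdd hA1 in
theorem abs_sum_sum_window_mom₂_sub_le (K : ℕ) (α β : Fin d) :
    |∑ n ∈ Finset.range N, ∑ m ∈ window N K n, mom₂ μ T f (n, α) (m, β)
        - N * covMatrix μ T f α β|
      ≤ C₂ * (2 * N * tail ρ (K + 1) + 2 * ∑' i : ℕ, ((i : ℝ) + 1) * ρ i) := by
  have h0 := hA1.rate_nonneg
  have hs := hA1.rate_summable
  have e : (N : ℝ) * covMatrix μ T f α β = ∑ _n ∈ Finset.range N, covMatrix μ T f α β := by simp
  rw [e, ← Finset.sum_sub_distrib]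
  refine (Finset.abs_sum_le_sum_abs _ _).trans ((Finset.sum_le_sum fun n hn =>
    abs_sum_window_mom₂_sub_le hT hf hf_bdd hA1 (Finset.mem_range.1 hn) α β).trans ?_)
  rw [← Finset.mul_sum]
  refine mul_le_mul_of_nonneg_left ?_ hA1.C₂_pos.le
  -- Reflecting `n ↦ N - 1 - n` turns the right boundary tails into the left ones; each family sums
  -- to at most `∑ (i+1) ρ(i)`.
  rw [Finset.sum_add_distrib, Finset.sum_add_distrib,
    Finset.sum_range_reflect (fun n => tail ρ (n + 1)) N]
  have h1 := sum_tail_le h0 hs N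
  simp only [Finset.sum_const, Finset.card_range, nsmul_eq_mul]
  linarith

include hT hf hf_bdd hA1 in
/-- The windowed covariation concentrates at the limiting covariance matrix. -/
theorem integral_abs_windowed_covariation_sub_le (hN : 0 < N) (K : ℕ) (α β : Fin d) :
    ∫ x, |(N : ℝ)⁻¹ * ∑ n ∈ Finset.range N, ∑ m ∈ window N K n, iter T f n x α * iter T f m x β
        - covMatrix μ T f α β| ∂μ
      ≤ 12 * max C₂ √C₄ * (∑' i : ℕ, ((i : ℝ) + 1) * ρ i)
        * (((K : ℝ) + 1) / √(N : ℝ) + tail ρ (K + 1)) := by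
  have h0 := hA1.rate_nonneg
  have hs := hA1.rate_summable
  set R := ∑' i : ℕ, ((i : ℝ) + 1) * ρ i with hR
  have hR1 : 1 ≤ R := one_le_tsum_succ_mul_rate h0 hs hA1.rate_zero
  set C := max C₂ √C₄ with hC
  have hC2 : C₂ ≤ C := le_max_left _ _
  have hC0 : 0 < C := hA1.C₂_pos.trans_le hC2
  have hN0 : (0 : ℝ) < N := Nat.cast_pos.2 hN
  have hsN : 0 < √(N : ℝ) := Real.sqrt_pos.2 hN0
  have hsq : √(N : ℝ) * √(N : ℝ) = N := Real.mul_self_sqrt hN0.le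
  have hfl := bddMeas_windowFluct (μ := μ) (N := N) hT hf hf_bdd K α β
  -- The constant 10 suffices because `56 * tail ρ 0 ≤ 56 R ≤ 100 R²`, using `R ≥ 1`; the bias below
  -- adds 2, giving 12.
  set c := 10 * C * R * ((K : ℝ) + 1) * √(N : ℝ) with hc
  have hc0 : 0 < c := by positivity
  have h1 : ∫ x, |windowFluct μ T f N K α β x| ∂μ ≤ c := by
    refine integral_abs_le_of_integral_sq_le hfl hc0
      ((integral_windowFluct_sq_le hT hf hf_bdd hA1 K α β hC2 (le_max_right _ _)).trans ?_)
    have e : c ^ 2 = N * (C ^ 2 * (100 * R ^ 2 * ((K : ℝ) + 1) ^ 2)) := by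
      rw [hc, mul_pow, sq √(N : ℝ), hsq]; ring
    rw [e]
    have h2 : tail ρ 0 ≤ R := tail_zero_le h0 hs
    have h3 : 56 * tail ρ 0 ≤ 100 * R ^ 2 := by nlinarith
    gcongr
  set b := (N : ℝ)⁻¹ * (∑ n ∈ Finset.range N, ∑ m ∈ window N K n, mom₂ μ T f (n, α) (m, β)
    - N * covMatrix μ T f α β) with hb
  have hb1 : |b| ≤ 2 * C * R * (1 / N + tail ρ (K + 1)) := by
    rw [hb, abs_mul, abs_of_pos (inv_pos.2 hN0), inv_mul_le_iff₀ hN0]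
    refine (abs_sum_sum_window_mom₂_sub_le hT hf hf_bdd hA1 K α β).trans ?_
    have ht := tail_nonneg h0 (K + 1)
    calc C₂ * (2 * N * tail ρ (K + 1) + 2 * R) ≤ C * (2 * N * (R * tail ρ (K + 1)) + 2 * R) := by
          gcongr
          exact le_mul_of_one_le_left ht hR1
      _ = _ := by field_simp; ring
  have e : ∀ x, (N : ℝ)⁻¹ * ∑ n ∈ Finset.range N, ∑ m ∈ window N K n,
      iter T f n x α * iter T f m x β - covMatrix μ T f α β
      = (N : ℝ)⁻¹ * windowFluct μ T f N K α β x + b := by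
    intro x
    rw [hb, windowFluct]
    simp only [Finset.sum_sub_distrib]
    field_simp
    ring
  simp_rw [e]
  calc _ ≤ ∫ x, ((N : ℝ)⁻¹ * |windowFluct μ T f N K α β x| + |b|) ∂μ := by
        refine integral_mono ((hfl.const_mul _).add (BddMeas.const _)).abs.integrable
          ((hfl.abs.const_mul _).add (BddMeas.const _)).integrable fun x => ?_
        refine (abs_add_le _ _).trans ?_
        rw [abs_mul, abs_of_pos (inv_pos.2 hN0)]
    _ = (N : ℝ)⁻¹ * ∫ x, |windowFluct μ T f N K α β x| ∂μ + |b| := by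
        rw [integral_add (hfl.abs.const_mul _).integrable (integrable_const _),
          integral_const_mul]
        simp
    _ ≤ (N : ℝ)⁻¹ * c + 2 * C * R * (1 / N + tail ρ (K + 1)) := by gcongr
    _ = 10 * C * R * (((K : ℝ) + 1) / √(N : ℝ)) + 2 * C * R * (1 / N + tail ρ (K + 1)) := by
        congr 1
        have h3 : (N : ℝ)⁻¹ * √(N : ℝ) = 1 / √(N : ℝ) := by
          rw [inv_mul_eq_div, div_eq_div_iff hN0.ne' hsN.ne', hsq, one_mul]
        rw [hc, mul_left_comm, h3]
        ring
    _ ≤ _ := by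
        have ht := tail_nonneg h0 (K + 1)
        have h3 : 1 / (N : ℝ) ≤ ((K : ℝ) + 1) / √(N : ℝ) := by
          have hs1 : 1 ≤ √(N : ℝ) := Real.one_le_sqrt.2 (Nat.one_le_cast.2 hN)
          have hK : (0 : ℝ) ≤ K := Nat.cast_nonneg K
          refine div_le_div₀ (by positivity) (by linarith) hsN ?_
          nlinarith
        have h4 : 2 * C * R * (1 / N) ≤ 2 * C * R * (((K : ℝ) + 1) / √(N : ℝ)) := by gcongr
        have h5 : 0 ≤ C * R * tail ρ (K + 1) := by positivity
        linarith

end Estimates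

/-! ### Partial derivatives of the test function -/

section Calculus

variable {d : ℕ} {h : EuclideanSpace ℝ (Fin d) → ℝ}

theorem hasFDerivAt_partialDeriv {k : ℕ} (hk : Differentiable ℝ (iteratedFDeriv ℝ k h))
    (a : Fin k → Fin d) (y : EuclideanSpace ℝ (Fin d)) :
    HasFDerivAt (partialDeriv h a)
      ((ContinuousMultilinearMap.apply ℝ (fun _ : Fin k => EuclideanSpace ℝ (Fin d)) ℝ
        fun i => EuclideanSpace.single (a i) 1).comp (fderiv ℝ (iteratedFDeriv ℝ k h) y)) y :=
  (ContinuousMultilinearMap.apply ℝ (fun _ : Fin k => EuclideanSpace ℝ (Fin d)) ℝ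
    fun i => EuclideanSpace.single (a i) 1).hasFDerivAt.comp y (hk y).hasFDerivAt

theorem pderiv_partialDeriv {k : ℕ} (hk : Differentiable ℝ (iteratedFDeriv ℝ k h))
    (a : Fin k → Fin d) (β : Fin d) :
    pderiv β (partialDeriv h a) = partialDeriv h (Fin.cons β a : Fin (k + 1) → Fin d) := by
  ext y
  rw [pderiv, (hasFDerivAt_partialDeriv hk a y).fderiv, partialDeriv,
    iteratedFDeriv_succ_apply_left]
  rfl

theorem differentiable_partialDeriv {k : ℕ} (hk : Differentiable ℝ (iteratedFDeriv ℝ k h))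
    (a : Fin k → Fin d) : Differentiable ℝ (partialDeriv h a) :=
  fun y => (hasFDerivAt_partialDeriv hk a y).differentiableAt

theorem partialDeriv_zero (a : Fin 0 → Fin d) : partialDeriv h a = h := by
  ext y
  simp [partialDeriv]

theorem abs_partialDeriv_le {k : ℕ} (hk : derivNorm k h < ∞) (a : Fin k → Fin d)
    (y : EuclideanSpace ℝ (Fin d)) : |partialDeriv h a y| ≤ (derivNorm k h).toReal := by
  have h1 : ‖partialDeriv h a y‖ₑ ≤ derivNorm k h :=
    le_iSup₂ (f := fun a y => ‖partialDeriv h a y‖ₑ) a y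
  have h2 := ENNReal.toReal_mono hk.ne h1
  rwa [toReal_enorm, Real.norm_eq_abs] at h2

/-- The expansion is made at the endpoint `y`, not at `y - w`. The second derivatives are then taken
at `v + uW`, the same point for every `n`, so the linear terms assemble into the windowed
covariation. -/
theorem abs_taylor_remainder_le {g : EuclideanSpace ℝ (Fin d) → ℝ} (hg : Differentiable ℝ g)
    (hg' : ∀ β, Differentiable ℝ (pderiv β g)) {M : ℝ}
    (hM : ∀ β γ y, |pderiv γ (pderiv β g) y| ≤ M) (y w : EuclideanSpace ℝ (Fin d)) :
    |g y - g (y - w) - ∑ β, w β * pderiv β g y| ≤ M * ∑ β, ∑ γ, |w β| * |w γ| := by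
  -- With the linear part subtracted, the derivative along the segment involves only increments of
  -- `∂_β g` over `(t - 1) • w`; bounding `|t - 1|` by 1 gives up the usual factor 1/2.
  have hd : ∀ t : ℝ, HasDerivAt (fun t : ℝ => g (y - w + t • w) - t * ∑ β, w β * pderiv β g y)
      (∑ β, w β * (pderiv β g (y - w + t • w) - pderiv β g y)) t := by
    intro t
    have h2 : HasDerivAt (fun t : ℝ => y - w + t • w) w t := by
      simpa using ((hasDerivAt_id t).smul_const w).const_add (y - w)
    have h3 := ((hg _).hasFDerivAt.comp_hasDerivAt t h2).sub
      ((hasDerivAt_id t).mul_const (∑ β, w β * pderiv β g y))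
    rw [fderiv_eq_sum_pderiv, one_mul, ← Finset.sum_sub_distrib] at h3
    simp only [mul_sub]
    exact h3
  have := norm_image_sub_le_of_norm_deriv_le_segment_01' (C := M * ∑ β, ∑ γ, |w β| * |w γ|)
    (fun t _ => (hd t).hasDerivWithinAt) fun t ht => by
      rw [Real.norm_eq_abs, Finset.mul_sum]
      refine (Finset.abs_sum_le_sum_abs _ _).trans (Finset.sum_le_sum fun β _ => ?_)
      have hM0 : 0 ≤ M := (abs_nonneg _).trans (hM β β 0)
      rw [abs_mul, ← Finset.mul_sum, mul_left_comm]
      refine mul_le_mul_of_nonneg_left ?_ (abs_nonneg _)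
      have h1 := abs_sub_le_of_pderiv (hg' β) (hM β) y ((t - 1) • w)
      rw [show y + (t - 1) • w = y - w + t • w by rw [sub_smul, one_smul]; abel] at h1
      refine h1.trans (mul_le_mul_of_nonneg_left (Finset.sum_le_sum fun γ _ => ?_) hM0)
      rw [PiLp.smul_apply, smul_eq_mul, abs_mul]
      refine mul_le_of_le_one_left (abs_nonneg _) ?_
      rw [abs_le]
      constructor <;> linarith [ht.1, ht.2]
  simp only [one_smul, one_mul, zero_smul, zero_mul, sub_add_cancel, add_zero, sub_zero,
    Real.norm_eq_abs] at this
  rwa [sub_right_comm] at this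

theorem inner_gradient_eq_sum (y w : EuclideanSpace ℝ (Fin d)) :
    inner ℝ w (gradient h y) = ∑ α, w α * pderiv α h y := by
  rw [← fderiv_eq_sum_pderiv, real_inner_comm, gradient, InnerProductSpace.toDual_symm_apply]

end Calculus

/-! ### The Stein operator along the dynamics -/

section Stein

variable {X : Type*} [MeasurableSpace X] {d : ℕ} {μ : Measure X} [IsProbabilityMeasure μ]
  {T : X → X} (hT : MeasurePreserving T μ μ) {f : X → EuclideanSpace ℝ (Fin d)}
  (hf : Measurable f) (hf_bdd : ∃ M : ℝ, ∀ x, ‖f x‖ ≤ M)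

omit [MeasurableSpace X] in
theorem W_apply (N : ℕ) (x : X) (α : Fin d) :
    W T f N x α = 1 / √(N : ℝ) * ∑ k ∈ Finset.range N, iter T f k x α := by
  simp [W, Finset.sum_apply]

omit [MeasurableSpace X] in
theorem W_sub_Wgap (N K n : ℕ) (x : X) :
    W T f N x - Wgap T f N K n x = (1 / √(N : ℝ)) • ∑ k ∈ window N K n, iter T f k x := by
  simp [Wgap]

omit [IsProbabilityMeasure μ] in
include hT hf_bdd in
-- `supNorm` is an essential bound, so it holds only almost everywhere; invariance carries the null
-- set back along `T^n`.
theorem ae_abs_iter_le_supNorm (n : ℕ) :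
    ∀ᵐ x ∂μ, ∀ α, |iter T f n x α| ≤ (supNorm μ f).toReal := by
  have hfin : supNorm μ f < ∞ := by
    obtain ⟨M, hM⟩ := hf_bdd
    refine lt_of_le_of_lt (iSup_le fun α => ?_) (ENNReal.ofReal_lt_top (r := M))
    rw [eLpNorm_exponent_top]
    refine eLpNormEssSup_le_of_ae_bound (Filter.Eventually.of_forall fun x => ?_)
    exact (PiLp.norm_apply_le (p := 2) (f x) α).trans (hM x)
  have h0 : ∀ᵐ x ∂μ, ∀ α, |f x α| ≤ (supNorm μ f).toReal := by
    rw [ae_all_iff]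
    intro α
    filter_upwards [ae_le_eLpNormEssSup (f := fun x => f x α) (μ := μ)] with x hx
    have h1 : ‖f x α‖ₑ ≤ supNorm μ f := by
      refine hx.trans ?_
      rw [← eLpNorm_exponent_top]
      exact le_iSup (fun α => eLpNorm (fun x => f x α) ∞ μ) α
    have h2 := ENNReal.toReal_mono hfin.ne h1
    rwa [toReal_enorm, Real.norm_eq_abs] at h2
  exact (hT.iterate n).quasiMeasurePreserving.ae h0

omit [IsProbabilityMeasure μ] in
include hT hf in
theorem measurable_W (N : ℕ) : Measurable (W T f N) := by
  have : ∀ n, Measurable (iter T f n) := fun n => hf.comp (hT.measurable.iterate n)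
  unfold W
  exact (Finset.measurable_sum _ fun n _ => this n).const_smul (1 / √(N : ℝ))

omit [IsProbabilityMeasure μ] in
include hT hf in
theorem measurable_Wgap (N K n : ℕ) : Measurable (Wgap T f N K n) := by
  have : ∀ n, Measurable (iter T f n) := fun n => hf.comp (hT.measurable.iterate n)
  unfold Wgap
  exact (measurable_W hT hf N).sub
    ((Finset.measurable_sum _ fun n _ => this n).const_smul (1 / √(N : ℝ)))

variable {N K : ℕ} {C₂ C₄ : ℝ} {ρ : ℕ → ℝ} (hA1 : CorrelationDecay μ T f N C₂ C₄ ρ)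
  {h : EuclideanSpace ℝ (Fin d) → ℝ}
  (hd1 : ∀ α, Differentiable ℝ (pderiv α h)) (hd2 : ∀ α β, Differentiable ℝ (pderiv β (pderiv α h)))
  {M₁ M₂ M₃ : ℝ} (hM1 : ∀ α y, |pderiv α h y| ≤ M₁)
  (hM2 : ∀ α β y, |pderiv β (pderiv α h) y| ≤ M₂)
  (hM3 : ∀ α β γ y, |pderiv γ (pderiv β (pderiv α h)) y| ≤ M₃)

omit [MeasurableSpace X] in
/-- The Stein operator splits into a gap term, a covariation term and a Taylor remainder. -/
theorem stein_decomposition (S : Matrix (Fin d) (Fin d) ℝ) (v : EuclideanSpace ℝ (Fin d)) (u : ℝ)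
    (x : X) :
    (∑ α, W T f N x α * pderiv α h (v + u • W T f N x))
        - u * ∑ α, ∑ β, S α β * pderiv β (pderiv α h) (v + u • W T f N x)
      = 1 / √(N : ℝ) * (∑ n ∈ Finset.range N, ∑ α, iter T f n x α
          * pderiv α h (v + u • Wgap T f N K n x))
        + u * (∑ α, ∑ β, ((N : ℝ)⁻¹ * ∑ n ∈ Finset.range N, ∑ m ∈ window N K n,
          iter T f n x α * iter T f m x β - S α β)
          * pderiv β (pderiv α h) (v + u • W T f N x))
        + 1 / √(N : ℝ) * ∑ n ∈ Finset.range N, ∑ α, iter T f n x α *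
          (pderiv α h (v + u • W T f N x) - pderiv α h (v + u • Wgap T f N K n x)
            - ∑ β, (u * (1 / √(N : ℝ) * ∑ m ∈ window N K n, iter T f m x β))
              * pderiv β (pderiv α h) (v + u • W T f N x)) := by
  have hN : 1 / √(N : ℝ) * (1 / √(N : ℝ)) = (N : ℝ)⁻¹ := by
    rw [one_div_mul_one_div, Real.mul_self_sqrt (Nat.cast_nonneg N), one_div]
  have e1 : ∑ α, W T f N x α * pderiv α h (v + u • W T f N x)
      = 1 / √(N : ℝ) * ∑ n ∈ Finset.range N, ∑ α, iter T f n x α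
        * pderiv α h (v + u • W T f N x) := by
    rw [Finset.sum_comm, Finset.mul_sum]
    simp only [W_apply, ← Finset.sum_mul, mul_assoc]
  have e2 : ∑ α, ∑ β, ((N : ℝ)⁻¹ * ∑ n ∈ Finset.range N, ∑ m ∈ window N K n,
        iter T f n x α * iter T f m x β - S α β) * pderiv β (pderiv α h) (v + u • W T f N x)
      = 1 / √(N : ℝ) * (∑ n ∈ Finset.range N, ∑ α, iter T f n x α *
          ∑ β, (1 / √(N : ℝ) * ∑ m ∈ window N K n, iter T f m x β)
              * pderiv β (pderiv α h) (v + u • W T f N x))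
        - ∑ α, ∑ β, S α β * pderiv β (pderiv α h) (v + u • W T f N x) := by
    simp only [sub_mul, Finset.sum_sub_distrib]
    congr 1
    rw [Finset.sum_comm (s := Finset.range N), Finset.mul_sum]
    refine Finset.sum_congr rfl fun α _ => ?_
    simp only [Finset.mul_sum (s := Finset.univ)]
    rw [Finset.sum_comm (s := Finset.range N), Finset.mul_sum]
    refine Finset.sum_congr rfl fun β _ => ?_
    rw [← hN, mul_assoc, mul_assoc]
    congr 1
    rw [Finset.sum_mul, Finset.mul_sum]
    refine Finset.sum_congr rfl fun n _ => ?_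
    rw [← Finset.mul_sum]
    ring
  rw [e1, e2]
  simp only [mul_sub, Finset.sum_sub_distrib, mul_assoc u, ← Finset.mul_sum]
  simp only [mul_left_comm _ u, ← Finset.mul_sum]
  ring

include hT hf hf_bdd hA1 hd1 hd2 hM1 hM2 hM3 in
theorem abs_integral_stein_le (hN : 0 < N) (hM2' : 0 ≤ M₂) (hM3' : 0 ≤ M₃) {r : ℝ}
    (hA2 : ∀ n < N, ∀ t : ℝ, 0 ≤ t → t ≤ 1 → ∀ v : EuclideanSpace ℝ (Fin d),
      |∫ x, inner ℝ (iter T f n x) (gradient h (v + t • Wgap T f N K n x)) ∂μ| ≤ r)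
    (v : EuclideanSpace ℝ (Fin d)) {u : ℝ} (hu0 : 0 ≤ u) (hu1 : u ≤ 1) :
    |∫ x, ((∑ α, W T f N x α * pderiv α h (v + u • W T f N x))
        - u * ∑ α, ∑ β, covMatrix μ T f α β * pderiv β (pderiv α h) (v + u • W T f N x)) ∂μ|
      ≤ √(N : ℝ) * r
        + (d : ℝ) ^ 2 * M₂ * (12 * max C₂ √C₄ * (∑' i : ℕ, ((i : ℝ) + 1) * ρ i)
          * (((K : ℝ) + 1) / √(N : ℝ) + tail ρ (K + 1)))
        + (d : ℝ) ^ 3 * (supNorm μ f).toReal * M₃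
          * (4 * max C₂ √C₄ * (∑' i : ℕ, ((i : ℝ) + 1) * ρ i) * (((K : ℝ) + 1) / √(N : ℝ))) := by
  have h0 := hA1.rate_nonneg
  have hs := hA1.rate_summable
  set R := ∑' i : ℕ, ((i : ℝ) + 1) * ρ i with hR
  set C := max C₂ √C₄ with hC
  set F := (supNorm μ f).toReal with hF
  have hF0 : 0 ≤ F := ENNReal.toReal_nonneg
  have hC2 : C₂ ≤ C := le_max_left _ _
  have hN0 : (0 : ℝ) < N := Nat.cast_pos.2 hN
  have hsN : 0 < √(N : ℝ) := Real.sqrt_pos.2 hN0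
  have hsq : √(N : ℝ) * √(N : ℝ) = N := Real.mul_self_sqrt hN0.le
  set c := 1 / √(N : ℝ) with hc
  have hc0 : 0 < c := by positivity
  have hcN : c * N = √(N : ℝ) := by
    rw [hc, one_div, inv_mul_eq_div, div_eq_iff hsN.ne', hsq]
  have hb := fun n α => bddMeas_iter hT hf hf_bdd n α
  have hy : Measurable fun x => v + u • W T f N x :=
    ((measurable_W hT hf N).const_smul u).const_add v
  have hyn : ∀ n, Measurable fun x => v + u • Wgap T f N K n x := fun n =>
    ((measurable_Wgap hT hf N K n).const_smul u).const_add v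
  have hG : ∀ α, BddMeas fun x => pderiv α h (v + u • W T f N x) := fun α =>
    ⟨(hd1 α).continuous.measurable.comp hy, M₁, fun _ => hM1 _ _⟩
  have hGn : ∀ n α, BddMeas fun x => pderiv α h (v + u • Wgap T f N K n x) := fun n α =>
    ⟨(hd1 α).continuous.measurable.comp (hyn n), M₁, fun _ => hM1 _ _⟩
  have hH : ∀ α β, BddMeas fun x => pderiv β (pderiv α h) (v + u • W T f N x) := fun α β =>
    ⟨(hd2 α β).continuous.measurable.comp hy, M₂, fun _ => hM2 _ _ _⟩
  have hSb : ∀ n β, BddMeas fun x => ∑ m ∈ window N K n, iter T f m x β := fun n β =>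
    BddMeas.sum _ fun m _ => hb m β
  have hI1n : ∀ n, BddMeas fun x => ∑ α, iter T f n x α
      * pderiv α h (v + u • Wgap T f N K n x) := fun n =>
    BddMeas.sum _ fun α _ => (hb n α).mul (hGn n α)
  have hI1 := (BddMeas.sum (Finset.range N) fun n _ => hI1n n).const_mul c
  have hQ : ∀ α β, BddMeas fun x => (N : ℝ)⁻¹ * ∑ n ∈ Finset.range N, ∑ m ∈ window N K n,
      iter T f n x α * iter T f m x β - covMatrix μ T f α β := fun α β =>
    ((BddMeas.sum _ fun n _ => BddMeas.sum _ fun m _ =>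
      (hb n α).mul (hb m β)).const_mul _).sub (BddMeas.const _)
  have hI2 := (BddMeas.sum Finset.univ fun α _ => BddMeas.sum Finset.univ fun β _ =>
    (hQ α β).mul (hH α β)).const_mul u
  have hr : ∀ n α, BddMeas fun x => pderiv α h (v + u • W T f N x)
      - pderiv α h (v + u • Wgap T f N K n x) - ∑ β, (u * (c * ∑ m ∈ window N K n, iter T f m x β))
        * pderiv β (pderiv α h) (v + u • W T f N x) := fun n α =>
    ((hG α).sub (hGn n α)).sub (BddMeas.sum _ fun β _ =>
      (((hSb n β).const_mul c).const_mul u).mul (hH α β))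
  have hI3 := (BddMeas.sum (Finset.range N) fun n _ => BddMeas.sum Finset.univ fun α _ =>
    (hb n α).mul (hr n α)).const_mul c
  simp_rw [stein_decomposition (K := K) (covMatrix μ T f) v u]
  rw [integral_add (hI1.add hI2).integrable hI3.integrable,
    integral_add hI1.integrable hI2.integrable]
  refine (abs_add_le _ _).trans (add_le_add ((abs_add_le _ _).trans (add_le_add ?_ ?_)) ?_)
  -- Gap term: `N` integrals, each at most `r` by near-orthogonality, with prefactor `1/√N`.
  · rw [integral_const_mul, integral_finsetSum _ fun n _ => (hI1n n).integrable, abs_mul,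
      abs_of_pos hc0]
    have h1 : ∀ n ∈ Finset.range N, |∫ x, ∑ α, iter T f n x α
        * pderiv α h (v + u • Wgap T f N K n x) ∂μ| ≤ r := fun n hn => by
      have := hA2 n (Finset.mem_range.1 hn) u hu0 hu1 v
      simp_rw [inner_gradient_eq_sum] at this
      exact this
    have h2 := (Finset.abs_sum_le_sum_abs _ _).trans (Finset.sum_le_sum h1)
    rw [Finset.sum_const, Finset.card_range, nsmul_eq_mul] at h2
    refine (mul_le_mul_of_nonneg_left h2 hc0.le).trans (le_of_eq ?_)
    rw [← mul_assoc, hcN]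
  -- Covariation term: `d²` entries, each an `L¹` deviation weighted by a second derivative; `u ≤ 1`
  -- is dropped.
  · rw [← Real.norm_eq_abs]
    refine (norm_integral_le_integral_norm _).trans ?_
    have h1 : ∀ x, ‖u * ∑ α, ∑ β, ((N : ℝ)⁻¹ * ∑ n ∈ Finset.range N, ∑ m ∈ window N K n,
        iter T f n x α * iter T f m x β - covMatrix μ T f α β)
        * pderiv β (pderiv α h) (v + u • W T f N x)‖
        ≤ ∑ α, ∑ β, M₂ * |(N : ℝ)⁻¹ * ∑ n ∈ Finset.range N, ∑ m ∈ window N K n,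
          iter T f n x α * iter T f m x β - covMatrix μ T f α β| := by
      intro x
      rw [Real.norm_eq_abs, abs_mul, abs_of_nonneg hu0]
      refine (mul_le_of_le_one_left (abs_nonneg _) hu1).trans ?_
      refine (Finset.abs_sum_le_sum_abs _ _).trans (Finset.sum_le_sum fun α _ => ?_)
      refine (Finset.abs_sum_le_sum_abs _ _).trans (Finset.sum_le_sum fun β _ => ?_)
      rw [abs_mul, mul_comm]
      exact mul_le_mul_of_nonneg_right (hM2 _ _ _) (abs_nonneg _)
    have hB : ∀ α, BddMeas fun x => ∑ β, M₂ * |(N : ℝ)⁻¹ * ∑ n ∈ Finset.range N,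
        ∑ m ∈ window N K n, iter T f n x α * iter T f m x β - covMatrix μ T f α β| := fun α =>
      BddMeas.sum _ fun β _ => (hQ α β).abs.const_mul M₂
    refine (integral_mono hI2.integrable.norm (BddMeas.sum _ fun α _ => hB α).integrable
      h1).trans ?_
    rw [integral_finsetSum _ fun α _ => (hB α).integrable]
    have h2 : ∀ α ∈ (Finset.univ : Finset (Fin d)), ∫ x, ∑ β, M₂ * |(N : ℝ)⁻¹
        * ∑ n ∈ Finset.range N, ∑ m ∈ window N K n, iter T f n x α * iter T f m x β
          - covMatrix μ T f α β| ∂μ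
        ≤ ∑ _β : Fin d, M₂ * (12 * C * R * (((K : ℝ) + 1) / √(N : ℝ) + tail ρ (K + 1))) := by
      intro α _
      rw [integral_finsetSum _ fun β _ => ((hQ α β).abs.const_mul M₂).integrable]
      refine Finset.sum_le_sum fun β _ => ?_
      rw [integral_const_mul]
      exact mul_le_mul_of_nonneg_left
        (integral_abs_windowed_covariation_sub_le hT hf hf_bdd hA1 hN K α β) hM2'
    refine (Finset.sum_le_sum h2).trans (le_of_eq ?_)
    simp only [Finset.sum_const, Finset.card_univ, Fintype.card_fin, nsmul_eq_mul]
    ring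
  -- Remainder: the prefactor and the two window increments give `N^{-3/2}`, against `N` summands.
  -- The bound does not depend on `α`, so that sum supplies the third factor `d`; the constant 4
  -- comes from `2(K+1) · 2R`.
  · rw [← Real.norm_eq_abs]
    refine (norm_integral_le_integral_norm _).trans ?_
    have hB : ∀ n β γ, BddMeas fun x => c * (F * (M₃ * (c ^ 2 *
        (|∑ m ∈ window N K n, iter T f m x β| * |∑ m ∈ window N K n, iter T f m x γ|)))) :=
      fun n β γ => (((((hSb n β).abs.mul (hSb n γ).abs).const_mul _).const_mul _).const_mul
        _).const_mul _
    have hBβ := fun n β => BddMeas.sum (Finset.univ : Finset (Fin d)) fun γ _ => hB n β γ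
    have hBα := fun n => BddMeas.sum (Finset.univ : Finset (Fin d)) fun β _ => hBβ n β
    have hBn := fun n => BddMeas.sum (Finset.univ : Finset (Fin d)) fun _ _ => hBα n
    have h1 : ∀ᵐ x ∂μ, ‖c * ∑ n ∈ Finset.range N, ∑ α, iter T f n x α *
          (pderiv α h (v + u • W T f N x) - pderiv α h (v + u • Wgap T f N K n x)
            - ∑ β, (u * (c * ∑ m ∈ window N K n, iter T f m x β))
              * pderiv β (pderiv α h) (v + u • W T f N x))‖
        ≤ ∑ n ∈ Finset.range N, ∑ _α : Fin d, ∑ β, ∑ γ, c * (F * (M₃ * (c ^ 2 *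
        (|∑ m ∈ window N K n, iter T f m x β| * |∑ m ∈ window N K n, iter T f m x γ|)))) := by
      filter_upwards [ae_all_iff.2 fun n => ae_abs_iter_le_supNorm hT hf_bdd n] with x hx
      rw [Real.norm_eq_abs, abs_mul, abs_of_pos hc0]
      refine (mul_le_mul_of_nonneg_left (Finset.abs_sum_le_sum_abs _ _) hc0.le).trans ?_
      rw [Finset.mul_sum]
      refine Finset.sum_le_sum fun n _ => ?_
      refine (mul_le_mul_of_nonneg_left (Finset.abs_sum_le_sum_abs _ _) hc0.le).trans ?_
      rw [Finset.mul_sum]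
      refine Finset.sum_le_sum fun α _ => ?_
      simp only [← Finset.mul_sum]
      rw [abs_mul]
      refine mul_le_mul_of_nonneg_left ?_ hc0.le
      refine mul_le_mul (hx n α) ?_ (abs_nonneg _) hF0
      have hw : ∀ β, (u • (W T f N x - Wgap T f N K n x)) β
          = u * (c * ∑ m ∈ window N K n, iter T f m x β) := by
        intro β
        rw [W_sub_Wgap]
        simp [hc, Finset.sum_apply]
      have h2 := abs_taylor_remainder_le (hd1 α) (hd2 α) (hM3 α) (v + u • W T f N x)
        (u • (W T f N x - Wgap T f N K n x))
      rw [show v + u • W T f N x - u • (W T f N x - Wgap T f N K n x)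
        = v + u • Wgap T f N K n x by rw [smul_sub]; abel] at h2
      simp only [hw] at h2
      refine h2.trans (mul_le_mul_of_nonneg_left ?_ hM3')
      simp only [Finset.mul_sum]
      refine Finset.sum_le_sum fun β _ => Finset.sum_le_sum fun γ _ => ?_
      simp only [← Finset.mul_sum, abs_mul, abs_of_nonneg hu0, abs_of_pos hc0]
      have h3 : u * u ≤ 1 := mul_le_one₀ hu1 hu0 hu1
      calc _ = u * u * (c ^ 2 * (|∑ m ∈ window N K n, iter T f m x β|
            * |∑ m ∈ window N K n, iter T f m x γ|)) := by ring
        _ ≤ _ := mul_le_of_le_one_left (by positivity) h3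
    refine (integral_mono_ae hI3.integrable.norm (BddMeas.sum _ fun n _ => hBn n).integrable
      h1).trans ?_
    rw [integral_finsetSum _ fun n _ => (hBn n).integrable]
    have h2 : ∀ n ∈ Finset.range N, ∫ x, ∑ _α : Fin d, ∑ β, ∑ γ, c * (F * (M₃ * (c ^ 2 *
        (|∑ m ∈ window N K n, iter T f m x β| * |∑ m ∈ window N K n, iter T f m x γ|)))) ∂μ
        ≤ ∑ _α : Fin d, ∑ _β : Fin d, ∑ _γ : Fin d,
          c * (F * (M₃ * (c ^ 2 * (C * ((2 * ((K : ℝ) + 1)) * (2 * R)))))) := by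
      intro n _
      rw [integral_finsetSum _ fun _ _ => (hBα n).integrable]
      refine Finset.sum_le_sum fun α _ => ?_
      rw [integral_finsetSum _ fun β _ => (hBβ n β).integrable]
      refine Finset.sum_le_sum fun β _ => ?_
      rw [integral_finsetSum _ fun γ _ => (hB n β γ).integrable]
      refine Finset.sum_le_sum fun γ _ => ?_
      simp only [integral_const_mul]
      have h3 := integral_abs_sum_window_mul_le hT hf hf_bdd hA1 K n β γ
      have h4 : tail ρ 0 ≤ R := tail_zero_le h0 hs
      have h5 := tail_nonneg h0 0
      have hK : (0 : ℝ) ≤ K := Nat.cast_nonneg K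
      have h6 : C₂ * ((2 * K + 1) * (2 * tail ρ 0)) ≤ C * ((2 * ((K : ℝ) + 1)) * (2 * R)) := by
        have := hA1.C₂_pos
        gcongr
        linarith
      have h7 := h3.trans h6
      gcongr
    refine (Finset.sum_le_sum h2).trans (le_of_eq ?_)
    simp only [Finset.sum_const, Finset.card_univ, Finset.card_range, Fintype.card_fin,
      nsmul_eq_mul]
    have e : (N : ℝ) * c ^ 2 = 1 := by
      rw [sq, ← mul_assoc, mul_comm (N : ℝ), hcN, hc, mul_one_div_cancel hsN.ne']
    calc _ = ((N : ℝ) * c ^ 2) * ((d : ℝ) ^ 3 * F * M₃ * (4 * C * R * (((K : ℝ) + 1) * c))) := by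
          ring
      _ = _ := by rw [e, hc]; ring

end Stein

end SteinDyn

/-! ### The normal approximation theorem -/

theorem theorem2p1 {X : Type*} [MeasurableSpace X] (μ : Measure X) [IsProbabilityMeasure μ]
    (T : X → X) (hT : MeasurePreserving T μ μ)
    (d : ℕ) (hd : 1 ≤ d)
    (f : X → EuclideanSpace ℝ (Fin d)) (hf : Measurable f)
    (hf_bdd : ∃ M : ℝ, ∀ x, ‖f x‖ ≤ M) (hf_mean : ∫ x, f x ∂μ = 0)
    (h : EuclideanSpace ℝ (Fin d) → ℝ)
    (hh : ∀ k < 3, Differentiable ℝ (iteratedFDeriv ℝ k h))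
    (hh_bdd : ∀ k, 1 ≤ k → k ≤ 3 → SteinDyn.derivNorm k h < ∞)
    (N K : ℕ) (hN : 0 < N) (hK : K < N)
    -- decay of correlations
    (C₂ C₄ : ℝ) (ρ : ℕ → ℝ) (hA1 : SteinDyn.CorrelationDecay μ T f N C₂ C₄ ρ)
    -- near-orthogonality
    (ρ' : ℕ → ℝ) (hρ' : ∀ i, 0 ≤ ρ' i)
    (hA2 : ∀ n < N, ∀ t : ℝ, 0 ≤ t → t ≤ 1 → ∀ v : EuclideanSpace ℝ (Fin d),
      |∫ x, inner ℝ (SteinDyn.iter T f n x)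
        (gradient h (v + t • SteinDyn.Wgap T f N K n x)) ∂μ| ≤ ρ' K)
    -- no direction in which `f` is a coboundary
    (hA3 : ∀ v : EuclideanSpace ℝ (Fin d), ‖v‖ = 1 →
      ¬ SteinDyn.IsCoboundaryInDirection μ T f v) :
    (∀ α β : Fin d, Summable fun n : ℕ => SteinDyn.covTerm μ T f (n + 1) α β) ∧
    (SteinDyn.covMatrix μ T f).IsSymm ∧
    (SteinDyn.covMatrix μ T f).PosDef ∧
    |(∫ x, h (SteinDyn.W T f N x) ∂μ)
        - SteinDyn.gaussianMean (SteinDyn.covMatrix μ T f) h|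
      ≤ SteinDyn.constStar μ f h C₂ C₄ ρ
          * (((K : ℝ) + 1) / √(N : ℝ) + ∑' i : ℕ, ρ (K + 1 + i))
        + √(N : ℝ) * ρ' K := by

  have hcov := SteinDyn.covMatrix_posDef hT hf hf_bdd hA1 hA3
  refine ⟨fun α β => SteinDyn.summable_covTerm hA1 α β, SteinDyn.covMatrix_isSymm, hcov, ?_⟩
  have e1 : ∀ α, SteinDyn.pderiv α h = SteinDyn.partialDeriv h (Fin.cons α Fin.elim0) := by
    intro α
    rw [← SteinDyn.pderiv_partialDeriv (hh 0 (by norm_num)), SteinDyn.partialDeriv_zero]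
  have e2 : ∀ α β, SteinDyn.pderiv β (SteinDyn.pderiv α h)
      = SteinDyn.partialDeriv h (Fin.cons β (Fin.cons α Fin.elim0)) := by
    intro α β
    rw [e1, SteinDyn.pderiv_partialDeriv (hh 1 (by norm_num))]
  have hd0 : Differentiable ℝ h := by
    have := SteinDyn.differentiable_partialDeriv (hh 0 (by norm_num)) Fin.elim0
    rwa [SteinDyn.partialDeriv_zero] at this
  have hd1 : ∀ α, Differentiable ℝ (SteinDyn.pderiv α h) := fun α => by
    rw [e1]
    exact SteinDyn.differentiable_partialDeriv (hh 1 (by norm_num)) _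
  have hd2 : ∀ α β, Differentiable ℝ (SteinDyn.pderiv β (SteinDyn.pderiv α h)) := fun α β => by
    rw [e2]
    exact SteinDyn.differentiable_partialDeriv (hh 2 (by norm_num)) _
  have hM1 : ∀ α y, |SteinDyn.pderiv α h y| ≤ (SteinDyn.derivNorm 1 h).toReal := fun α y => by
    rw [e1]
    exact SteinDyn.abs_partialDeriv_le (hh_bdd 1 le_rfl (by norm_num)) _ y
  have hM2 : ∀ α β y, |SteinDyn.pderiv β (SteinDyn.pderiv α h) y|
      ≤ (SteinDyn.derivNorm 2 h).toReal := fun α β y => by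
    rw [e2]
    exact SteinDyn.abs_partialDeriv_le (hh_bdd 2 (by norm_num) (by norm_num)) _ y
  have hM3 : ∀ α β γ y, |SteinDyn.pderiv γ (SteinDyn.pderiv β (SteinDyn.pderiv α h)) y|
      ≤ (SteinDyn.derivNorm 3 h).toReal := fun α β γ y => by
    rw [e2, SteinDyn.pderiv_partialDeriv (hh 2 (by norm_num))]
    exact SteinDyn.abs_partialDeriv_le (hh_bdd 3 (by norm_num) le_rfl) _ y
  -- Like the bound on first derivatives, this crude bound serves only integrability and leaves no
  -- trace in the final estimate.
  obtain ⟨A, hA⟩ : ∃ A, ∀ x α, |SteinDyn.W T f N x α| ≤ A := by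
    obtain ⟨M, hM⟩ := hf_bdd
    refine ⟨1 / √(N : ℝ) * (N * M), fun x α => ?_⟩
    rw [SteinDyn.W_apply, abs_mul, abs_of_nonneg (by positivity)]
    refine mul_le_mul_of_nonneg_left ((Finset.abs_sum_le_sum_abs _ _).trans
      ((Finset.sum_le_sum fun k _ =>
        (PiLp.norm_apply_le (p := 2) (SteinDyn.iter T f k x) α).trans (hM _)).trans ?_))
      (by positivity)
    simp
  refine (SteinDyn.abs_integral_sub_gaussianMean_le μ (SteinDyn.measurable_W hT hf N) hA
    hcov.posSemidef hd0 hd1 (fun α β => (hd2 α β).continuous) hM1 hM2 fun v u hu0 hu1 =>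
      SteinDyn.abs_integral_stein_le hT hf hf_bdd hA1 hd1 hd2 hM1 hM2 hM3 hN
        ENNReal.toReal_nonneg ENNReal.toReal_nonneg hA2 v hu0 hu1).trans ?_
  have hR := SteinDyn.one_le_tsum_succ_mul_rate hA1.rate_nonneg hA1.rate_summable hA1.rate_zero
  have ht := SteinDyn.tail_nonneg hA1.rate_nonneg (K + 1)
  have hC : 0 < max C₂ √C₄ := hA1.C₂_pos.trans_le (le_max_left _ _)
  rw [SteinDyn.constStar]
  change _ ≤ _ * (((K : ℝ) + 1) / √(N : ℝ) + SteinDyn.tail ρ (K + 1)) + _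
  set R := ∑' i : ℕ, ((i : ℝ) + 1) * ρ i
  set C := max C₂ √C₄
  set t := SteinDyn.tail ρ (K + 1)
  set a := ((K : ℝ) + 1) / √(N : ℝ)
  have ha : 0 ≤ a := by positivity
  have hM2' : 0 ≤ (SteinDyn.derivNorm 2 h).toReal := ENNReal.toReal_nonneg
  have hM3' : 0 ≤ (SteinDyn.derivNorm 3 h).toReal := ENNReal.toReal_nonneg
  have hF : 0 ≤ (SteinDyn.supNorm μ f).toReal := ENNReal.toReal_nonneg
  set M₂ := (SteinDyn.derivNorm 2 h).toReal
  set M₃ := (SteinDyn.derivNorm 3 h).toReal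
  set F := (SteinDyn.supNorm μ f).toReal
  -- The covariation term carries only `d²`; `d ≥ 1` raises it to the common factor `d³`.
  have h1 : (d : ℝ) ^ 2 * M₂ * (12 * C * R * (a + t))
      ≤ (d : ℝ) ^ 3 * M₂ * (12 * C * R * (a + t)) := by
    have hd' : (1 : ℝ) ≤ d := by exact_mod_cast hd
    gcongr
    norm_num
  have h2 : (d : ℝ) ^ 3 * F * M₃ * (4 * C * R * a)
      ≤ (d : ℝ) ^ 3 * F * M₃ * (12 * C * R * (a + t)) := by
    gcongr
    · norm_num
    · linarith
  linarith
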